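/- Let $A$ be a complete discrete valuation ring of mixed characteristic $p>0$ with uniformizer $\pi_A$, and assume that $A$ is unramified, i.e. $p\notin\pi_A^2A$. Let $(R,\mathfrak m,k)$ be a complete Noetherian local domain, and let $A\to R$ be a flat local homomorphism that induces an isomorphism of residue fields $A/\pi_AA\cong R/\mathfrak m=k$. Assume that $k$ is infinite, and let $\pi_A,x_1,\dots,x_d$ be minimal generators of $\mathfrak m$ (that is, their classes form a basis of $\mathfrak m/\mathfrak m^2$ over $k$). Then only finitely many prime ideals $\mathfrak q_1,\dots,\mathfrak q_n$ of $R$ contain the ideal $(x_1,\dots,x_d)$. Moreover, let $\mathbb P^{d-1}(A)$ be the set of tuples $\widetilde\alpha=(\widetilde\alpha_1,\dots,\widetilde\alpha_d)\in A^d$ with $\pi_A\nmid\widetilde\alpha_i$ for some $i$, modulo multiplication by units of $A$; a tuple $\widetilde\alpha$ representing $\alpha\in\mathbb P^{d-1}(A)$ is called a lift of $\alpha$. Let $\mathrm{Sp}_A:\mathbb P^{d-1}(A)\to\mathbb P^{d-1}(k)$ be reduction of the coordinates of a lift modulo $\pi_A$. For a prime $\mathfrak p$ of $R$ put $\mathfrak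 p^{(2)}:=\mathfrak p^2R_{\mathfrak p}\cap R$. Then there is a Zariski-dense open subset $U\subset\mathbb P^{d-1}(k)$ such that $$\sum_{i=1}^d\widetilde\alpha_i x_i\notin\mathfrak p^{(2)}$$ for every $\mathfrak p\in\operatorname{Spec}R\setminus\{\mathfrak q_1,\dots,\mathfrak q_n\}$, every $\alpha\in\mathrm{Sp}_A^{-1}(U)$ and every lift $\widetilde\alpha$ of $\alpha$. -/

import Mathlib

open IsLocalRing
open scoped LinearAlgebra.Projectivization

/-- The `n`-th symbolic power `p⁽ⁿ⁾ = pⁿ Rₚ ∩ R` of a prime ideal `p`. -/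
def symbolicPower {R : Type*} [CommRing R] (p : Ideal R) [p.IsPrime] (n : ℕ) : Ideal R :=
  ((p ^ n).map (algebraMap R (Localization.AtPrime p))).comap
    (algebraMap R (Localization.AtPrime p))

/-- `y₁, …, yₙ` are minimal generators of the maximal ideal `𝔪` of a Noetherian local ring: they
lie in `𝔪` and their classes form a basis of `𝔪 / 𝔪²` over the residue field. -/
def IsMinimalGenerators {R : Type*} [CommRing R] [IsLocalRing R] {n : ℕ} (y : Fin n → R) : Prop :=
  ∃ hy : ∀ i, y i ∈ maximalIdeal R,
    LinearIndependent (ResidueField R)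
      (fun i => ((maximalIdeal R).toCotangent ⟨y i, hy i⟩ : CotangentSpace R)) ∧
    Submodule.span (ResidueField R)
      (Set.range fun i => ((maximalIdeal R).toCotangent ⟨y i, hy i⟩ : CotangentSpace R)) = ⊤

/-- A discrete valuation ring of mixed characteristic `p` in which `p ∉ 𝔪²`. -/
structure IsUnramifiedMixedChar (A : Type*) [CommRing A] [IsDomain A] [IsDiscreteValuationRing A]
    (p : ℕ) : Prop where
  prime : p.Prime
  charZero : CharZero A
  residueChar : CharP (ResidueField A) p
  notMem_sq : (p : A) ∉ maximalIdeal A ^ 2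

/-- A flat local map of local rings inducing an isomorphism of residue fields. (That source and
target are complete, and that the source is an unramified discrete valuation ring of mixed
characteristic, is assumed separately.) -/
structure IsCoefficientRingMap (A R : Type*) [CommRing A] [IsLocalRing A] [CommRing R]
    [IsLocalRing R] [Algebra A R] : Prop where
  isLocalHom : IsLocalHom (algebraMap A R)
  flat : Module.Flat A R
  residue_bijective : Function.Bijective (ResidueField.map (algebraMap A R))

/-- The set of points of `ℙ^{d-1}(k)` (lines in `k^d`) at which `f` does not vanish; used only for
homogeneous `f`, when this does not depend on the chosen representative. -/
def projBasicOpen {k : Type*} [Field k] {d : ℕ} (f : MvPolynomial (Fin d) k) :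
    Set (ℙ k (Fin d → k)) :=
  {P | MvPolynomial.eval P.rep f ≠ 0}

theorem mk_mem_projBasicOpen {k : Type*} [Field k] {d n : ℕ} {f : MvPolynomial (Fin d) k}
    (hf : f.IsHomogeneous n) (v : Fin d → k) (hv : v ≠ 0) :
    Projectivization.mk k v hv ∈ projBasicOpen f ↔ MvPolynomial.eval v f ≠ 0 := by
  obtain ⟨a, ha⟩ := Projectivization.exists_smul_eq_mk_rep k v hv
  have h : MvPolynomial.eval ((a : k) • v) f = (a : k) ^ n * MvPolynomial.eval v f := by
    simp only [MvPolynomial.eval_eq, Finset.mul_sum, Pi.smul_apply, smul_eq_mul, mul_pow,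
      Finset.prod_mul_distrib]
    refine Finset.sum_congr rfl fun m hm => ?_
    rw [Finset.prod_pow_eq_pow_sum]
    have h2 := hf (MvPolynomial.mem_support_iff.mp hm)
    rw [← h2, Finsupp.weight_apply, Finsupp.sum]
    simp only [Pi.one_apply, smul_eq_mul, mul_one]
    ring
  have h' : (Projectivization.mk k v hv).rep = (a : k) • v := ha.symm
  simp [projBasicOpen, h', h]

/-- The Zariski topology on the set `ℙ^{d-1}(k)` of rational points: the non-vanishing loci of
homogeneous polynomials form a basis of open sets. -/
instance zariskiTopology {k : Type*} [Field k] {d : ℕ} : TopologicalSpace (ℙ k (Fin d → k)) :=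
  TopologicalSpace.generateFrom
    {U | ∃ (n : ℕ) (f : MvPolynomial (Fin d) k), f.IsHomogeneous n ∧ U = projBasicOpen f}

/-- Normalized `d`-tuples over a local ring: some coordinate is a unit (for a discrete valuation
ring: is not divisible by a uniformizer). -/
def NormalizedTuple (A : Type*) [CommRing A] (d : ℕ) : Type _ :=
  {v : Fin d → A // ∃ i, IsUnit (v i)}

/-- Two normalized tuples are equivalent if they differ by a unit of `A`. -/
instance normalizedTupleSetoid (A : Type*) [CommRing A] (d : ℕ) :
    Setoid (NormalizedTuple A d) where
  r v w := ∃ u : Aˣ, ∀ i, w.1 i = u * v.1 i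
  iseqv :=
    { refl := fun _ => ⟨1, fun _ => by simp⟩
      symm := fun ⟨u, hu⟩ => ⟨u⁻¹, fun i => by rw [hu i, Units.inv_mul_cancel_left]⟩
      trans := fun ⟨u, hu⟩ ⟨u', hu'⟩ =>
        ⟨u' * u, fun i => by rw [hu' i, hu i, Units.val_mul, mul_assoc]⟩ }

/-- `ℙ^{d-1}(A)`: normalized `d`-tuples up to units of `A`. -/
def ProjPoints (A : Type*) [CommRing A] (d : ℕ) : Type _ :=
  Quotient (normalizedTupleSetoid A d)

/-- The point `(v₁ : ⋯ : v_d)` of `ℙ^{d-1}(A)` of which `v` is a lift. -/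
def NormalizedTuple.toProj {A : Type*} [CommRing A] {d : ℕ} (v : NormalizedTuple A d) :
    ProjPoints A d :=
  Quotient.mk _ v

theorem NormalizedTuple.residue_ne_zero {A : Type*} [CommRing A] [IsLocalRing A] {d : ℕ}
    (v : NormalizedTuple A d) : (fun i => residue A (v.1 i)) ≠ 0 := by
  obtain ⟨i, hi⟩ := v.2
  intro h
  exact (hi.map (residue A)).ne_zero (congrFun h i)

/-- The specialization map `ℙ^{d-1}(A) → ℙ^{d-1}(k)`, `k` the residue field of `A`: reduce the
coordinates of a normalized lift modulo the maximal ideal. -/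
noncomputable def specialization (A : Type*) [CommRing A] [IsLocalRing A] (d : ℕ) :
    ProjPoints A d → ℙ (ResidueField A) (Fin d → ResidueField A) :=
  Quotient.lift
    (fun v : NormalizedTuple A d =>
      Projectivization.mk (ResidueField A) (fun i => residue A (v.1 i)) v.residue_ne_zero)
    (by
      rintro v w ⟨u, hu⟩
      refine Eq.symm ((Projectivization.mk_eq_mk_iff' _ _ _ _ _).2 ⟨residue A u, ?_⟩)
      funext i
      simp [hu i])

/-!
Write `R = S / (f₁, …, f_m)` with `S = A⟦X₁, …, X_d⟧`, where `Xᵢ ↦ xᵢ`. If `x_v = ∑ vᵢ xᵢ` lies in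
`p⁽²⁾`, differentiating a representation of `s ∑ vᵢ Xᵢ` as an element of `P² + (f₁, …, f_m)` with
respect to the `Xᵢ` shows that, in the residue field of `p`, the vector `v` is a combination of
the rows of the Jacobian matrix `(∂fⱼ/∂Xᵢ)`: it is a conormal vector of `Spec R` at `p`. So `v`
satisfies all equations in the kernel of the conormal map `ψ : R[T] → R[λ]`, `Tᵢ ↦ ∑ⱼ (∂fⱼ/∂Xᵢ)
λⱼ`; it also satisfies `∑ xᵢ Tᵢ = 0`.

It suffices to find a polynomial `g` over `R`, nonzero modulo `𝔪`, that vanishes modulo `p` at all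
such `v`; a homogeneous component of its reduction modulo `𝔪` then defines the open set `U`. If
`ker ψ` is not contained in the prime `M = 𝔪 R[T]`, any `g ∈ ker ψ \ M` will do. Otherwise a
dimension count (`le_height_ker_add_height_ker_conormalMap`), which rests on the fact that in
characteristic zero a Jacobian determinant bounds the height of a prime from below
(`Ideal.le_height_of_det_notMem`), leaves no room for a prime strictly between `ker ψ` and `M`. If
`ψ (∑ xᵢ Tᵢ) ≠ 0`, every component of its zero locus therefore gives the required equation, except
those lying over the closed point of `Spec R`, where all `xᵢ` vanish.

There remains the case `ψ (∑ xᵢ Tᵢ) = 0`. Then the Euler derivation `∑ Xᵢ ∂/∂Xᵢ` of `S` descends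
to `R` and acts on the local ring of `R[T] / ker ψ` at `M`, annihilating the parameter `π` and a
set of representatives of the residue field, whereas it fixes the `xᵢ`. Such a derivation has no
nonzero eigenvector of eigenvalue `1` (`Derivation.eq_zero_of_apply_eq_self`): modulo each power
of `π` an eigenvector is a root of a monic polynomial with constant coefficients and of bounded
degree, from which the derivation isolates the leading term. So all `xᵢ` vanish and there is
nothing to prove.
-/

/-! ### Derivations and heights of prime ideals -/

theorem Derivation.sum_smul_apply {k B ι : Type*} [CommRing k] [CommRing B] [Algebra k B]
    [Fintype ι] (c : ι → B) (D : ι → Derivation k B B) (b : B) :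
    (∑ i, c i • D i) b = ∑ i, c i * D i b := by
  have h := congrFun (map_sum (Derivation.coeFnAddMonoidHom (R := k) (A := B) (M := B))
    (fun i => c i • D i) Finset.univ) b
  simp only [Finset.sum_apply] at h
  exact h

theorem Derivation.exists_int_sum_smul {k B ι : Type*} [CommRing k] [CommRing B] [Algebra k B]
    [Fintype ι] (c : ι → B) (D : ι → Derivation k B B) :
    ∃ E : Derivation ℤ B B, ∀ b, E b = ∑ i, c i * D i b :=
  ⟨(∑ i, c i • D i).restrictScalars ℤ, fun b => Derivation.sum_smul_apply c D b⟩

theorem Derivation.apply_mem_span {C : Type*} [CommRing C] (D : Derivation ℤ C C) {s : Set C}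
    (hs : ∀ a ∈ s, D a ∈ Ideal.span s) : ∀ a ∈ Ideal.span s, D a ∈ Ideal.span s := by
  intro a ha
  induction ha using Submodule.span_induction with
  | mem a ha => exact hs a ha
  | zero => simp
  | add x y _ _ hx hy => rw [map_add]; exact Ideal.add_mem _ hx hy
  | smul c x hx hDx =>
    rw [smul_eq_mul, Derivation.leibniz]
    exact Ideal.add_mem _ (Ideal.mul_mem_left _ _ hDx) (Ideal.mul_mem_right _ _ hx)

theorem Ideal.exists_mul_pow_mem_of_mem_minimalPrimes {C : Type*} [CommRing C] {J q : Ideal C}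
    (hq : q ∈ J.minimalPrimes) {a : C} (ha : a ∈ q) : ∃ s ∉ q, ∃ n : ℕ, s * a ^ n ∈ J := by
  have := hq.isPrime
  by_contra! h
  have hdisj :
      Disjoint (J : Set C) ((q.primeCompl ⊔ Submonoid.powers a : Submonoid C) : Set C) := by
    rw [Set.disjoint_left]
    intro z hz hz'
    obtain ⟨s, hs, _, ⟨n, rfl⟩, rfl⟩ := Submonoid.mem_sup.mp hz'
    exact h s hs n hz
  obtain ⟨q', hq', hJ, hd⟩ := Ideal.exists_le_prime_disjoint J _ hdisj
  have hle : q' ≤ q := fun z hz => by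
    by_contra hzq
    exact Set.disjoint_left.mp hd hz (Submonoid.mem_sup_left (T := .powers a) hzq)
  have : a ∈ q' := hq.2 ⟨hq', hJ⟩ hle ha
  exact Set.disjoint_left.mp hd this
    (Submonoid.mem_sup_right (S := q.primeCompl) (Submonoid.mem_powers a))

/-- In residue characteristic zero, a prime minimal over an ideal stable under a derivation is
itself stable under it. -/
theorem Derivation.apply_mem_of_mem_minimalPrimes {C : Type*} [CommRing C] {J q : Ideal C}
    (hq : q ∈ J.minimalPrimes) (hchar : ∀ n : ℕ, n ≠ 0 → (n : C) ∉ q)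
    (D : Derivation ℤ C C) (hD : ∀ a ∈ J, D a ∈ J) {a : C} (ha : a ∈ q) : D a ∈ q := by
  classical
  have := hq.isPrime
  by_contra hDa
  have hex : ∃ n : ℕ, ∃ s ∉ q, s * a ^ n ∈ J := by
    obtain ⟨s, hs, n, h⟩ := Ideal.exists_mul_pow_mem_of_mem_minimalPrimes hq ha
    exact ⟨n, s, hs, h⟩
  obtain ⟨s, hs, hsJ⟩ := Nat.find_spec hex
  have hpos : Nat.find hex ≠ 0 := fun h0 => by
    rw [h0, pow_zero, mul_one] at hsJ
    exact hs (hq.1.2 hsJ)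
  obtain ⟨n, hn⟩ := Nat.exists_eq_succ_of_ne_zero hpos
  refine Nat.find_min hex (m := n) (by omega) ⟨s * s * (n + 1 : ℕ) * D a, ?_, ?_⟩
  · exact fun h => (this.mem_or_mem h).elim (fun h => (this.mem_or_mem h).elim
      (fun h => (this.mem_or_mem h).elim hs hs) (hchar _ n.succ_ne_zero)) hDa
  · rw [hn] at hsJ
    have h1 := hD _ hsJ
    rw [Derivation.leibniz, Derivation.leibniz_pow] at h1
    have h2 := J.sub_mem (J.mul_mem_left s h1) (J.mul_mem_left (D s) hsJ)
    convert h2 using 1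
    simp only [smul_eq_mul, nsmul_eq_mul, Nat.succ_eq_add_one, Nat.add_sub_cancel]
    ring

/-- If the Jacobian determinant of `h` elements of a prime `M` with respect to `h` derivations does
not lie in `M`, and the residue characteristic is zero, then `M` has height at least `h`: the primes
minimal over the first `t` elements are stable under the derivations killing these elements, so
they do not contain the next one. -/
theorem Ideal.le_height_of_det_notMem {C : Type*} [CommRing C] (M : Ideal C) [M.IsPrime]
    (hchar : ∀ n : ℕ, n ≠ 0 → (n : C) ∉ M) {h : ℕ} (f : Fin h → C) (hf : ∀ j, f j ∈ M)
    (D : Fin h → Derivation ℤ C C) (hdet : (Matrix.of fun i j => D i (f j)).det ∉ M) :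
    (h : ℕ∞) ≤ M.height := by
  classical
  set W : Matrix (Fin h) (Fin h) C := Matrix.of fun i j => D i (f j) with hW
  -- the derivations dual to the `f j`, up to the determinant
  let D' : Fin h → Derivation ℤ C C := fun i => ∑ l, W.adjugate i l • D l
  have hD' : ∀ i j, D' i (f j) = if i = j then W.det else 0 := by
    intro i j
    have : D' i (f j) = (W.adjugate * W) i j := Derivation.sum_smul_apply _ _ _
    rw [this, Matrix.adjugate_mul, Matrix.smul_apply, Matrix.one_apply]
    simp
  have key : ∀ t : ℕ, t ≤ h → ∀ q : Ideal C, q.IsPrime → q ≤ M →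
      (∀ j : Fin h, (j : ℕ) < t → f j ∈ q) → (t : ℕ∞) ≤ q.height := by
    intro t
    induction t with
    | zero => intros; simp
    | succ t ih =>
      intro ht q hq hqM hfq
      let J : Ideal C := Ideal.span (f '' {j | (j : ℕ) < t})
      have hJq : J ≤ q := by
        rw [Ideal.span_le]
        rintro _ ⟨j, hj, rfl⟩
        exact hfq j (Nat.lt_succ_of_lt hj)
      obtain ⟨q', hq', hle⟩ := Ideal.exists_minimalPrimes_le hJq
      have hprime := hq'.isPrime
      have h1 := ih (by omega) q' hq'.isPrime (hle.trans hqM)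
        (fun j hj => hq'.1.2 (Ideal.subset_span ⟨j, hj, rfl⟩))
      let j₀ : Fin h := ⟨t, ht⟩
      have hstab : ∀ a ∈ J, D' j₀ a ∈ J := by
        refine Derivation.apply_mem_span _ ?_
        rintro _ ⟨j, hj, rfl⟩
        have hne : j₀ ≠ j := fun h0 => by
          rw [← h0] at hj
          exact lt_irrefl t hj
        rw [hD', if_neg hne]
        exact J.zero_mem
      have hnot : f j₀ ∉ q' := fun hmem => by
        have := Derivation.apply_mem_of_mem_minimalPrimes hq'
          (fun n hn h0 => hchar n hn (hqM (hle h0))) (D' j₀) hstab hmem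
        rw [hD', if_pos rfl] at this
        exact hdet (hqM (hle this))
      have hlt : q' < q := lt_of_le_of_ne hle fun h0 => hnot (h0 ▸ hfq j₀ (Nat.lt_succ_self t))
      push_cast
      exact (add_le_add_left h1 1).trans (Ideal.height_add_one_le_of_lt_of_isPrime hlt)
  exact key h le_rfl M inferInstance le_rfl fun j _ => hf j

theorem Ideal.height_ker_add_height_le {S R : Type*} [CommRing S] [CommRing R] [IsDomain R]
    {φ : S →+* R} (hφ : Function.Surjective φ) (q : Ideal R) [hq : q.IsPrime] :
    (RingHom.ker φ).height + q.height ≤ (q.comap φ).height := by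
  have key : ∀ n : ℕ, ∀ q : Ideal R, q.IsPrime → (n : ℕ∞) ≤ q.height →
      (RingHom.ker φ).height + n ≤ (q.comap φ).height := by
    intro n
    induction n with
    | zero =>
      intro q hq _
      rw [Nat.cast_zero, add_zero]
      exact Ideal.height_mono (Ideal.comap_mono bot_le)
    | succ n ih =>
      intro q hq hn
      have : ¬ q.height ≤ n := fun h => by
        have := hn.trans h
        norm_cast at this
        omega
      rw [Ideal.height_le_iff] at this
      push Not at this
      obtain ⟨q', hq', hlt, hn'⟩ := this
      have h1 := ih q' hq' hn'
      have hlt' : q'.comap φ < q.comap φ :=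
        lt_of_le_of_ne (Ideal.comap_mono hlt.le)
          fun h => hlt.ne (Ideal.comap_injective_of_surjective φ hφ h)
      push_cast
      rw [← add_assoc]
      exact (add_le_add_left h1 1).trans (Ideal.height_add_one_le_of_lt_of_isPrime hlt')
  rcases eq_or_ne q.height ⊤ with h | h
  · rw [h, add_top, top_le_iff, ENat.eq_top_iff_forall_ge]
    intro n
    exact le_trans le_add_self (key n q hq (by simp [h]))
  · obtain ⟨n, hn⟩ := ENat.ne_top_iff_exists.mp h
    rw [← hn]
    exact key n q hq hn.le

theorem MvPolynomial.comap_C_map_C {σ R : Type*} [CommRing R] (I : Ideal R) :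
    (I.map (MvPolynomial.C : R →+* MvPolynomial σ R)).comap MvPolynomial.C = I := by
  refine le_antisymm (fun a ha => ?_) Ideal.le_comap_map
  have := MvPolynomial.mem_map_C_iff.mp (Ideal.mem_comap.mp ha) 0
  simpa using this

theorem MvPolynomial.map_C_eq_ker_map {σ R : Type*} [CommRing R] (I : Ideal R) :
    I.map (MvPolynomial.C : R →+* MvPolynomial σ R) =
      RingHom.ker (MvPolynomial.map (σ := σ) (Ideal.Quotient.mk I)) := by
  rw [MvPolynomial.ker_map, Ideal.mk_ker]

theorem MvPolynomial.isPrime_map_C {σ R : Type*} [CommRing R] (I : Ideal R) [I.IsPrime] :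
    (I.map (MvPolynomial.C : R →+* MvPolynomial σ R)).IsPrime := by
  rw [MvPolynomial.map_C_eq_ker_map]
  exact RingHom.ker_isPrime _

theorem MvPolynomial.height_map_C_le {σ R : Type*} [Finite σ] [CommRing R] [IsNoetherianRing R]
    (m : Ideal R) [m.IsPrime] :
    (m.map (MvPolynomial.C : R →+* MvPolynomial σ R)).height ≤ m.height := by
  classical
  obtain ⟨s, hs, hcard⟩ := m.exists_finset_card_eq_height_of_isNoetherianRing
  have hp : (m.map (MvPolynomial.C : R →+* MvPolynomial σ R)).IsPrime :=
    MvPolynomial.isPrime_map_C m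
  rw [← hcard]
  have hmem : m.map (MvPolynomial.C : R →+* MvPolynomial σ R) ∈
      (Ideal.span ((s.image MvPolynomial.C : Finset (MvPolynomial σ R)) :
        Set (MvPolynomial σ R))).minimalPrimes := by
    rw [Finset.coe_image, ← Ideal.map_span]
    refine ⟨⟨hp, Ideal.map_mono hs.1.2⟩, ?_⟩
    rintro q ⟨hq, hsq⟩ hqm
    have h1 : q.comap MvPolynomial.C ≤ m := by
      simpa [MvPolynomial.comap_C_map_C] using Ideal.comap_mono (f := MvPolynomial.C) hqm
    exact Ideal.map_le_iff_le_comap.mpr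
      (hs.2 ⟨Ideal.comap_isPrime _ _, Ideal.map_le_iff_le_comap.mp hsq⟩ h1)
  refine (Ideal.height_le_card_of_mem_minimalPrimes_span_finset hmem).trans ?_
  exact_mod_cast Finset.card_image_le

/-- Vectors over a domain that are linearly independent over the fraction field have a dual family
up to a common denominator. -/
theorem LinearIndependent.exists_dual {R F : Type*} [CommRing R] [IsDomain R] [Field F]
    [Algebra R F] [IsFractionRing R F] {ι : Type*} [Fintype ι] {h : ℕ} {w : Fin h → ι → F}
    (hw : LinearIndependent F w) :
    ∃ (c : Fin h → ι → R) (u : R), u ≠ 0 ∧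
      ∀ i j, ∑ l, algebraMap R F (c i l) * w j l = if i = j then algebraMap R F u else 0 := by
  classical
  obtain ⟨g, hg⟩ := LinearMap.exists_leftInverse_of_injective
    (Fintype.linearCombination F w) (LinearMap.ker_eq_bot.mpr hw.fintypeLinearCombination_injective)
  let c' : Fin h × ι → F := fun il => g (Pi.single il.2 1) il.1
  obtain ⟨b, hb⟩ := IsLocalization.exist_integer_multiples_of_finite (nonZeroDivisors R) c'
  choose c hc using hb
  refine ⟨fun i l => c (i, l), b, nonZeroDivisors.coe_ne_zero b, fun i j => ?_⟩
  have h1 : g (w j) i = if i = j then 1 else 0 := by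
    have h2 := congrFun (LinearMap.congr_fun hg (Pi.single j 1)) i
    simpa [Fintype.linearCombination_apply, Pi.single_apply] using h2
  have h3 : w j = ∑ l, w j l • (Pi.single l (1 : F) : ι → F) := by
    ext l
    simp [Finset.sum_apply, Pi.single_apply]
  have h4 : g (w j) i = ∑ l, w j l * c' (i, l) := by
    conv_lhs => rw [h3]
    simp [c', map_sum, Finset.sum_apply]
  calc ∑ l, algebraMap R F (c (i, l)) * w j l
      = algebraMap R F b * g (w j) i := by
        rw [h4, Finset.mul_sum]
        refine Finset.sum_congr rfl fun l _ => ?_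
        rw [hc, Algebra.smul_def]
        ring
    _ = _ := by rw [h1]; simp

/-! ### Extending derivations -/

/-- A ring homomorphism `b ↦ b + ε D b` to the dual numbers defines a derivation `D`. -/
theorem Derivation.exists_of_dualNumber {B : Type*} [CommRing B] (Φ : B →+* DualNumber B)
    (hΦ : ∀ b, (Φ b).fst = b) : ∃ D : Derivation ℤ B B, ∀ b, D b = (Φ b).snd := by
  refine ⟨Derivation.mk' (AddMonoidHom.toIntLinearMap
    ((TrivSqZeroExt.sndHom B B).toAddMonoidHom.comp Φ.toAddMonoidHom)) fun a b => ?_, fun _ => rfl⟩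
  change (Φ (a * b)).snd = a • (Φ b).snd + b • (Φ a).snd
  rw [map_mul, TrivSqZeroExt.snd_mul, hΦ, hΦ, op_smul_eq_smul]

/-- The homomorphism `b ↦ g b + ε g (D b)` to the dual numbers attached to a derivation `D` and a
ring homomorphism `g`. -/
def Derivation.toDualNumber {B B' : Type*} [CommRing B] [CommRing B'] (D : Derivation ℤ B B)
    (g : B →+* B') : B →+* DualNumber B' where
  toFun b := TrivSqZeroExt.inl (g b) + TrivSqZeroExt.inr (g (D b))
  map_one' := by simp
  map_mul' a b := by
    ext
    · simp
    · simp
      ring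
  map_zero' := by simp
  map_add' a b := by
    ext <;> simp

theorem Derivation.fst_toDualNumber {B B' : Type*} [CommRing B] [CommRing B']
    (D : Derivation ℤ B B) (g : B →+* B') (b : B) :
    (D.toDualNumber g b).fst = g b := by
  simp [Derivation.toDualNumber]

theorem Derivation.snd_toDualNumber {B B' : Type*} [CommRing B] [CommRing B']
    (D : Derivation ℤ B B) (g : B →+* B') (b : B) :
    (D.toDualNumber g b).snd = g (D b) := by
  simp [Derivation.toDualNumber]

theorem Derivation.exists_of_surjective {S R : Type*} [CommRing S] [CommRing R] {φ : S →+* R}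
    (hφ : Function.Surjective φ) (D : Derivation ℤ S S)
    (hD : ∀ a ∈ RingHom.ker φ, D a ∈ RingHom.ker φ) :
    ∃ D' : Derivation ℤ R R, ∀ a, D' (φ a) = φ (D a) := by
  have hker : RingHom.ker φ ≤ RingHom.ker (D.toDualNumber φ) := fun a ha => by
    rw [RingHom.mem_ker]
    ext
    · rw [Derivation.fst_toDualNumber]
      exact ha
    · rw [Derivation.snd_toDualNumber]
      exact hD a ha
  let Φ := φ.liftOfSurjective hφ ⟨D.toDualNumber φ, hker⟩
  have hΦ : ∀ a, Φ (φ a) = D.toDualNumber φ a := fun a =>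
    RingHom.liftOfRightInverse_comp_apply φ _ (Function.rightInverse_surjInv hφ) ⟨_, hker⟩ a
  obtain ⟨D', hD'⟩ := Derivation.exists_of_dualNumber Φ fun b => by
    obtain ⟨a, rfl⟩ := hφ b
    rw [hΦ, Derivation.fst_toDualNumber]
  exact ⟨D', fun a => by rw [hD', hΦ, Derivation.snd_toDualNumber]⟩

theorem Derivation.exists_mvPolynomial {R σ : Type*} [CommRing R] (D : Derivation ℤ R R)
    (e : σ → MvPolynomial σ R) :
    ∃ D' : Derivation ℤ (MvPolynomial σ R) (MvPolynomial σ R),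
      (∀ r, D' (MvPolynomial.C r) = MvPolynomial.C (D r)) ∧ ∀ i, D' (MvPolynomial.X i) = e i := by
  let Φ : MvPolynomial σ R →+* DualNumber (MvPolynomial σ R) :=
    MvPolynomial.eval₂Hom (D.toDualNumber MvPolynomial.C)
      fun i => TrivSqZeroExt.inl (MvPolynomial.X i) + TrivSqZeroExt.inr (e i)
  have hC : ∀ r, Φ (MvPolynomial.C r) = D.toDualNumber MvPolynomial.C r :=
    MvPolynomial.eval₂Hom_C _ _
  have hX : ∀ i, Φ (MvPolynomial.X i) =
      TrivSqZeroExt.inl (MvPolynomial.X i) + TrivSqZeroExt.inr (e i) :=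
    MvPolynomial.eval₂Hom_X' _ _
  have hΦ : ∀ b, (Φ b).fst = b := by
    intro b
    induction b using MvPolynomial.induction_on with
    | C r => rw [hC, Derivation.fst_toDualNumber]
    | add p q hp hq => rw [map_add, TrivSqZeroExt.fst_add, hp, hq]
    | mul_X p i hp => rw [map_mul, TrivSqZeroExt.fst_mul, hp, hX]; simp
  obtain ⟨D', hD'⟩ := Derivation.exists_of_dualNumber Φ hΦ
  refine ⟨D', fun r => (hD' _).trans ?_, fun i => (hD' _).trans ?_⟩
  · rw [hC, Derivation.snd_toDualNumber]
  · rw [hX]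
    simp

theorem Derivation.exists_isLocalization {B K : Type*} [CommRing B] [CommRing K] [Algebra B K]
    (M : Submonoid B) [IsLocalization M K] (D : Derivation ℤ B B) :
    ∃ D' : Derivation ℤ K K, ∀ b, D' (algebraMap B K b) = algebraMap B K (D b) := by
  have hunit : ∀ s : M, IsUnit (D.toDualNumber (algebraMap B K) s) := fun s => by
    rw [TrivSqZeroExt.isUnit_iff_isUnit_fst, Derivation.fst_toDualNumber]
    exact IsLocalization.map_units K s
  let Φ : K →+* DualNumber K := IsLocalization.lift hunit
  have hΦ : ∀ b, Φ (algebraMap B K b) = D.toDualNumber (algebraMap B K) b :=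
    IsLocalization.lift_eq hunit
  have hid : (TrivSqZeroExt.fstHom K K K).toRingHom.comp Φ = RingHom.id K :=
    IsLocalization.ringHom_ext M (RingHom.ext fun b => by
      change (Φ (algebraMap B K b)).fst = algebraMap B K b
      rw [hΦ, Derivation.fst_toDualNumber])
  obtain ⟨D', hD'⟩ := Derivation.exists_of_dualNumber Φ (RingHom.congr_fun hid)
  refine ⟨D', fun b => (hD' _).trans ?_⟩
  rw [hΦ, Derivation.snd_toDualNumber]

/-! ### Eigenvectors of a derivation -/

/-- Let `E` be a derivation of a `π`-adically separated domain `O` of characteristic zero with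
`E π = 0`, such that `O / π` is spanned by finitely many elements over the constants of `E`. Then
`E x = x` only for `x = 0`: modulo `π ^ N`, the element `x` is a root of a monic polynomial with
constant coefficients whose degree `e` does not depend on `N`, and `(E - 0) ⋯ (E - (e - 1))` kills
all terms of this relation except the leading one, so that `π ^ N` divides `e! x ^ e`. -/
theorem Derivation.eq_zero_of_apply_eq_self {O : Type*} [CommRing O] [IsDomain O] [CharZero O]
    (E : Derivation ℤ O O) {π : O} (hπ : E π = 0) (hsep : ∀ y, (∀ N : ℕ, π ^ N ∣ y) → y = 0)
    {ι : Type*} [Fintype ι] (w : ι → O)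
    (hw : ∀ y, ∃ c : ι → O, (∀ i, E (c i) = 0) ∧ π ∣ y - ∑ i, c i * w i)
    {x : O} (hx : E x = x) : x = 0 := by
  classical
  -- the ring of constants
  let 𝒞 : Subring O :=
    { carrier := {c | E c = 0}
      mul_mem' := fun {a b} ha hb => by
        change E (a * b) = 0
        rw [Derivation.leibniz, show E a = 0 from ha, show E b = 0 from hb, smul_zero, smul_zero,
          add_zero]
      one_mem' := E.map_one_eq_zero
      add_mem' := fun {a b} ha hb => by
        change E (a + b) = 0
        rw [map_add, show E a = 0 from ha, show E b = 0 from hb, add_zero]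
      zero_mem' := map_zero E
      neg_mem' := fun {a} ha => by
        change E (-a) = 0
        rw [map_neg, show E a = 0 from ha, neg_zero] }
  have hconst : ∀ c : 𝒞, E (c : O) = 0 := fun c => c.2
  have hwN : ∀ N : ℕ, ∀ y, ∃ c : ι → 𝒞, π ^ N ∣ y - ∑ i, (c i : O) * w i := by
    intro N
    induction N with
    | zero => exact fun y => ⟨0, by simp⟩
    | succ N ih =>
      intro y
      obtain ⟨c, z, hz⟩ := ih y
      obtain ⟨c', hc', z', hz'⟩ := hw z
      refine ⟨fun i => c i + ⟨π, hπ⟩ ^ N * ⟨c' i, hc' i⟩, z', ?_⟩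
      have h1 : ∑ i, ((c i + (⟨π, hπ⟩ : 𝒞) ^ N * ⟨c' i, hc' i⟩ : 𝒞) : O) * w i =
          ∑ i, (c i : O) * w i + π ^ N * ∑ i, c' i * w i := by
        rw [Finset.mul_sum, ← Finset.sum_add_distrib]
        refine Finset.sum_congr rfl fun i _ => ?_
        push_cast
        ring
      rw [h1, pow_succ, mul_assoc, ← hz']
      linear_combination hz
  have hEpow : ∀ i : ℕ, E (x ^ i) = i * x ^ i := by
    intro i
    rw [Derivation.leibniz_pow, hx]
    cases i with
    | zero => simp
    | succ i => simp [pow_succ, mul_comm]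
  have hEdvd : ∀ N : ℕ, ∀ y, π ^ N ∣ y → π ^ N ∣ E y := by
    rintro N _ ⟨z, rfl⟩
    rw [Derivation.leibniz, Derivation.leibniz_pow, hπ]
    simp
  set e := Fintype.card ι with he
  suffices h : (e.factorial : O) * x ^ e = 0 by
    rcases mul_eq_zero.mp h with h | h
    · exact absurd (Nat.cast_eq_zero.mp h) e.factorial_ne_zero
    · exact eq_zero_of_pow_eq_zero h
  refine hsep _ fun N => ?_
  choose b hb using fun l => hwN N (x * w l)
  let B : Matrix ι ι 𝒞 := Matrix.of b
  -- the characteristic polynomial of multiplication by `x` modulo `π ^ N`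
  let χ := B.charpoly
  have hdet : Polynomial.eval₂ 𝒞.subtype x χ =
      (Matrix.scalar ι x - B.map 𝒞.subtype).det := by
    rw [← Matrix.eval_charpoly, Matrix.charpoly_map, Polynomial.eval_map]
  have hχw : ∀ l, π ^ N ∣ Polynomial.eval₂ 𝒞.subtype x χ * w l := by
    intro l
    set W := Matrix.scalar ι x - B.map 𝒞.subtype with hW
    have h1 : W.det * w l = (W.adjugate.mulVec (W.mulVec w)) l := by
      rw [Matrix.mulVec_mulVec, Matrix.adjugate_mul, Matrix.smul_mulVec, Matrix.one_mulVec]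
      rfl
    rw [hdet, h1, Matrix.mulVec, dotProduct]
    refine Finset.dvd_sum fun j _ => Dvd.dvd.mul_left ?_ _
    have h2 : W.mulVec w j = x * w j - ∑ i, (b j i : O) * w i := by
      rw [hW, Matrix.sub_mulVec]
      simp [Matrix.mulVec, dotProduct, B]
    rw [h2]
    exact hb j
  have hχ : π ^ N ∣ ∑ i ∈ Finset.range (e + 1), (χ.coeff i : O) * x ^ i := by
    have h1 : Polynomial.eval₂ 𝒞.subtype x χ =
        ∑ i ∈ Finset.range (e + 1), (χ.coeff i : O) * x ^ i := by
      rw [Polynomial.eval₂_eq_sum_range, Matrix.charpoly_natDegree_eq_dim]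
      rfl
    rw [← h1]
    obtain ⟨c, z, hz⟩ := hwN N 1
    have h2 : Polynomial.eval₂ 𝒞.subtype x χ =
        ∑ i, (c i : O) * (Polynomial.eval₂ 𝒞.subtype x χ * w i) +
          π ^ N * (z * Polynomial.eval₂ 𝒞.subtype x χ) := by
      have h3 : ∑ i, (c i : O) * (Polynomial.eval₂ 𝒞.subtype x χ * w i) =
          Polynomial.eval₂ 𝒞.subtype x χ * ∑ i, (c i : O) * w i := by
        rw [Finset.mul_sum]
        exact Finset.sum_congr rfl fun i _ => by ring
      rw [h3]
      linear_combination Polynomial.eval₂ 𝒞.subtype x χ * hz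
    rw [h2]
    exact dvd_add (Finset.dvd_sum fun i _ => (hχw i).mul_left _) (dvd_mul_right _ _)
  have hfall : ∀ t : ℕ, π ^ N ∣
      ∑ i ∈ Finset.range (e + 1), (χ.coeff i : O) * (i.descFactorial t : O) * x ^ i := by
    intro t
    induction t with
    | zero => simpa using hχ
    | succ t ih =>
      have h1 := (hEdvd N _ ih).sub (ih.mul_left (t : O))
      convert h1 using 1
      rw [map_sum, Finset.mul_sum, ← Finset.sum_sub_distrib]
      refine Finset.sum_congr rfl fun i _ => ?_
      rw [Derivation.leibniz, Derivation.leibniz, hconst, hEpow, E.map_natCast]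
      have h2 : ((i.descFactorial (t + 1) : ℕ) : O) = ((i : O) - t) * (i.descFactorial t : O) := by
        rcases le_or_gt t i with h | h
        · rw [Nat.descFactorial_succ]
          push_cast [Nat.cast_sub h]
          ring
        · rw [Nat.descFactorial_eq_zero_iff_lt.mpr h,
            Nat.descFactorial_eq_zero_iff_lt.mpr (h.trans (Nat.lt_succ_self t))]
          simp
      rw [h2]
      simp only [smul_eq_mul]
      ring
  have h1 := hfall e
  rw [Finset.sum_range_succ, Finset.sum_eq_zero, zero_add, Nat.descFactorial_self] at h1
  · have h2 : χ.coeff e = 1 := by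
      have := B.charpoly_monic
      rwa [Polynomial.Monic, Polynomial.leadingCoeff, Matrix.charpoly_natDegree_eq_dim] at this
    simpa [h2] using h1
  · intro i hi
    rw [Nat.descFactorial_eq_zero_iff_lt.mpr (Finset.mem_range.mp hi)]
    simp

/-- The finiteness hypothesis of `Derivation.eq_zero_of_apply_eq_self` holds if `O` is a Noetherian
local ring, `O / π` has finite length, and the residue field is represented by constants. -/
theorem Derivation.eq_zero_of_apply_eq_self_of_isLocalRing {O : Type*} [CommRing O] [IsDomain O]
    [CharZero O] [IsLocalRing O] [IsNoetherianRing O] (E : Derivation ℤ O O) {π : O}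
    (hπ : E π = 0) (hmem : π ∈ maximalIdeal O)
    (hrad : ∃ a : ℕ, maximalIdeal O ^ a ≤ Ideal.span {π})
    (hres : ∀ z, ∃ c, E c = 0 ∧ z - c ∈ maximalIdeal O)
    {x : O} (hx : E x = x) : x = 0 := by
  have hsep : ∀ y, (∀ N : ℕ, π ^ N ∣ y) → y = 0 := by
    intro y hy
    have h1 : y ∈ ⨅ N : ℕ, maximalIdeal O ^ N := by
      rw [Submodule.mem_iInf]
      intro N
      obtain ⟨z, rfl⟩ := hy N
      exact Ideal.mul_mem_right _ _ (Ideal.pow_mem_pow hmem N)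
    rwa [Ideal.iInf_pow_eq_bot_of_isLocalRing _ (maximalIdeal.isMaximal O).ne_top] at h1
  have hspan : ∀ a : ℕ, ∃ (n : ℕ) (w : Fin n → O), ∀ y, ∃ c : Fin n → O,
      (∀ i, E (c i) = 0) ∧ y - ∑ i, c i * w i ∈ maximalIdeal O ^ a := by
    intro a
    induction a with
    | zero => exact ⟨0, Fin.elim0, fun y => ⟨Fin.elim0, fun i => i.elim0, by simp⟩⟩
    | succ a ih =>
      obtain ⟨n, w, hw⟩ := ih
      obtain ⟨b, g, hg⟩ := Submodule.fg_iff_exists_fin_generating_family.mp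
        (IsNoetherian.noetherian (maximalIdeal O ^ a))
      refine ⟨n + b, Fin.append w g, fun y => ?_⟩
      obtain ⟨c, hc, hy⟩ := hw y
      rw [← hg, Submodule.mem_span_range_iff_exists_fun] at hy
      obtain ⟨z, hz⟩ := hy
      choose c' hc' hz' using fun k => hres (z k)
      refine ⟨Fin.append c c', fun i => ?_, ?_⟩
      · refine Fin.addCases (fun i => ?_) (fun i => ?_) i
        · rw [Fin.append_left, hc]
        · rw [Fin.append_right, hc']
      · have h1 : y - ∑ i, Fin.append c c' i * Fin.append w g i = ∑ k, (z k - c' k) * g k := by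
          rw [Fin.sum_univ_add]
          simp only [Fin.append_left, Fin.append_right, sub_mul, Finset.sum_sub_distrib]
          simp only [smul_eq_mul] at hz
          rw [hz]
          ring
        rw [h1, pow_succ']
        refine Ideal.sum_mem _ fun k _ => Ideal.mul_mem_mul (hz' k) ?_
        rw [← hg]
        exact Submodule.subset_span ⟨k, rfl⟩
  obtain ⟨a, ha⟩ := hrad
  obtain ⟨n, w, hw⟩ := hspan a
  refine E.eq_zero_of_apply_eq_self hπ hsep w (fun y => ?_) hx
  obtain ⟨c, hc, hy⟩ := hw y
  exact ⟨c, hc, Ideal.mem_span_singleton.mp (ha hy)⟩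

/-! ### Presenting a complete local ring by a power series ring -/

theorem MvPowerSeries.mem_span_range_X {σ A : Type*} [Fintype σ] [CommRing A]
    {f : MvPowerSeries σ A} (hf : MvPowerSeries.constantCoeff f = 0) :
    f ∈ Ideal.span (Set.range (MvPowerSeries.X : σ → MvPowerSeries σ A)) := by
  classical
  -- a variable occurring in the monomial of exponent `n`
  let i₀ : (σ →₀ ℕ) → Option σ := fun n => if h : ∃ i, n i ≠ 0 then some h.choose else none
  let g : σ → MvPowerSeries σ A := fun i n =>
    if i₀ (n + Finsupp.single i 1) = some i then MvPowerSeries.coeff (n + Finsupp.single i 1) f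
    else 0
  have hfg : f = ∑ i, g i * MvPowerSeries.X i := by
    ext n
    have hterm : ∀ i, MvPowerSeries.coeff n (g i * MvPowerSeries.X i) =
        if i₀ n = some i then MvPowerSeries.coeff n f else 0 := by
      intro i
      rw [MvPowerSeries.X, MvPowerSeries.coeff_mul_monomial]
      by_cases hle : Finsupp.single i 1 ≤ n
      · rw [if_pos hle, mul_one]
        change (if i₀ (n - Finsupp.single i 1 + Finsupp.single i 1) = some i then
          MvPowerSeries.coeff (n - Finsupp.single i 1 + Finsupp.single i 1) f else 0) = _
        rw [tsub_add_cancel_of_le hle]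
      · rw [if_neg hle, if_neg]
        intro h0
        apply hle
        by_cases hex : ∃ i, n i ≠ 0
        · have h1 : hex.choose = i := by
            simpa [i₀, hex] using h0
          rw [Finsupp.single_le_iff, ← h1]
          exact Nat.one_le_iff_ne_zero.mpr hex.choose_spec
        · simp [i₀, hex] at h0
    rw [map_sum, Finset.sum_congr rfl fun i _ => hterm i]
    by_cases hex : ∃ i, n i ≠ 0
    · have h1 : i₀ n = some hex.choose := by simp only [i₀, dif_pos hex]
      simp [h1]
    · have h0 : n = 0 := by
        ext i
        by_contra h
        exact hex ⟨i, h⟩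
      subst h0
      simp [hf]
  rw [hfg]
  exact Ideal.sum_mem _ fun i _ => Ideal.mul_mem_left _ _ (Ideal.subset_span ⟨i, rfl⟩)

theorem MvPowerSeries.exists_ringHom_X_eq {A R : Type*} [CommRing A] [CommRing R] [Algebra A R]
    (J : Ideal R) [IsAdicComplete J R] {d : ℕ} (x : Fin d → R) (hx : ∀ i, x i ∈ J) :
    ∃ φ : MvPowerSeries (Fin d) A →+* R, (∀ a, φ (MvPowerSeries.C a) = algebraMap A R a) ∧
      ∀ i, φ (MvPowerSeries.X i) = x i := by
  have hle : ∀ n, MvPolynomial.idealOfVars (Fin d) A ^ n ≤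
      (J ^ n).comap (MvPolynomial.aeval (R := A) x).toRingHom := by
    intro n
    rw [← Ideal.map_le_iff_le_comap, Ideal.map_pow]
    refine Ideal.pow_right_mono ?_ n
    rw [Ideal.map_span, Ideal.span_le]
    rintro _ ⟨_, ⟨i, rfl⟩, rfl⟩
    simpa using hx i
  let f : ∀ n, MvPowerSeries (Fin d) A →+* R ⧸ J ^ n := fun n =>
    (Ideal.quotientMap (J ^ n) _ (hle n)).comp
      (MvPowerSeries.truncTotalAlgHom (Fin d) A n).toRingHom
  have hfapply : ∀ n p, f n p = Ideal.Quotient.mk (J ^ n)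
      (MvPolynomial.aeval x (MvPowerSeries.truncTotal n p)) := fun n p => rfl
  have hcomp : ∀ {m n : ℕ} (hle : m ≤ n),
      (Ideal.Quotient.factorPow J hle).comp (f n) = f m := by
    intro m n hmn
    ext p
    rw [RingHom.comp_apply, hfapply, hfapply]
    change Ideal.Quotient.mk (J ^ m) _ = _
    rw [Ideal.Quotient.eq, ← map_sub]
    exact hle m (MvPowerSeries.truncTotal_sub_truncTotal_mem_pow_idealOfVars hmn le_rfl p)
  have hpoly : ∀ (n) (p : MvPolynomial (Fin d) A), f n (p : MvPowerSeries (Fin d) A) =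
      Ideal.Quotient.mk (J ^ n) (MvPolynomial.aeval x p) := by
    intro n p
    rw [hfapply, Ideal.Quotient.eq, ← map_sub]
    refine hle n ((MvPolynomial.mem_pow_idealOfVars_iff' ..).mpr fun y hy => ?_)
    rw [MvPolynomial.coeff_sub, sub_eq_zero, MvPowerSeries.coeff_truncTotal _ hy,
      MvPolynomial.coeff_coe]
  let φ := IsAdicComplete.liftRingHom J f hcomp
  have hφ : ∀ p : MvPolynomial (Fin d) A, φ (p : MvPowerSeries (Fin d) A) =
      MvPolynomial.aeval x p := by
    intro p
    refine congrFun (IsHausdorff.funext' J (f := fun _ : Unit => φ p)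
      (g := fun _ => MvPolynomial.aeval x p) fun n _ => ?_) ()
    rw [← hpoly]
    exact IsAdicComplete.mk_liftRingHom J f hcomp n _
  refine ⟨φ, fun a => ?_, fun i => ?_⟩
  · rw [← MvPolynomial.coe_C, hφ, MvPolynomial.aeval_C]
  · rw [← MvPolynomial.coe_X, hφ, MvPolynomial.aeval_X]

section

variable {A R : Type*} [CommRing A] [IsLocalRing A] [CommRing R] [IsLocalRing R]
  [Algebra A R] [IsLocalHom (algebraMap A R)] {π : A} {d : ℕ} {x : Fin d → R}

theorem algebraMap_quotient_span_surjective [IsPrecomplete (maximalIdeal A) A]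
    [IsNoetherianRing R] (hπ : π ∈ maximalIdeal A)
    (hres : ∀ r : R, ∃ a : A, r - algebraMap A R a ∈ maximalIdeal R)
    (hm : maximalIdeal R = Ideal.span {algebraMap A R π} ⊔ Ideal.span (Set.range x)) :
    Function.Surjective (algebraMap A (R ⧸ Ideal.span (Set.range x))) := by
  set J := Ideal.span (Set.range x) with hJ
  have hJm : J ≤ maximalIdeal R := hm ▸ le_sup_right
  have hnt : Nontrivial (R ⧸ J) :=
    Ideal.Quotient.nontrivial_iff.mpr fun h => (maximalIdeal.isMaximal R).ne_top
      (top_le_iff.mp (h ▸ hJm))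
  have hl : IsLocalRing (R ⧸ J) :=
    IsLocalRing.of_surjective' (Ideal.Quotient.mk J) Ideal.Quotient.mk_surjective
  have hlh : IsLocalHom (Ideal.Quotient.mk J) :=
    IsLocalHom.of_surjective _ Ideal.Quotient.mk_surjective
  have hcomp : algebraMap A (R ⧸ J) = (Ideal.Quotient.mk J).comp (algebraMap A R) := rfl
  have hle : (maximalIdeal A).map (algebraMap A (R ⧸ J)) ≤ maximalIdeal (R ⧸ J) := by
    rw [hcomp]
    exact map_maximalIdeal_le _
  have hH : IsHausdorff ((maximalIdeal A).map (algebraMap A (R ⧸ J))) (R ⧸ J) :=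
    IsHausdorff.of_le_jacobson _ _ (hle.trans (maximalIdeal_le_jacobson _))
  refine surjective_of_mk_map_comp_surjective (I := maximalIdeal A) _ fun z => ?_
  obtain ⟨y, rfl⟩ := Ideal.Quotient.mk_surjective z
  obtain ⟨r, rfl⟩ := Ideal.Quotient.mk_surjective y
  obtain ⟨a, ha⟩ := hres r
  refine ⟨a, ?_⟩
  rw [hm, Submodule.mem_sup] at ha
  obtain ⟨u, hu, v, hv, huv⟩ := ha
  obtain ⟨c, rfl⟩ := Ideal.mem_span_singleton'.mp hu
  rw [RingHom.comp_apply, eq_comm, Ideal.Quotient.eq, hcomp, RingHom.comp_apply, ← map_sub, ← huv,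
    map_add, Ideal.Quotient.eq_zero_iff_mem.mpr hv, add_zero, map_mul]
  exact Ideal.mul_mem_left _ _ (Ideal.mem_map_of_mem _ hπ)

theorem surjective_of_map_X_eq [IsPrecomplete (maximalIdeal A) A] [IsNoetherianRing R]
    (hπ : π ∈ maximalIdeal A)
    (hres : ∀ r : R, ∃ a : A, r - algebraMap A R a ∈ maximalIdeal R)
    (hm : maximalIdeal R = Ideal.span {algebraMap A R π} ⊔ Ideal.span (Set.range x))
    {φ : MvPowerSeries (Fin d) A →+* R} (hC : ∀ a, φ (MvPowerSeries.C a) = algebraMap A R a)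
    (hX : ∀ i, φ (MvPowerSeries.X i) = x i) : Function.Surjective φ := by
  have hmap : (Ideal.span (Set.range (MvPowerSeries.X : Fin d → MvPowerSeries (Fin d) A))).map φ =
      Ideal.span (Set.range x) := by
    rw [Ideal.map_span, ← Set.range_comp]
    congr 2
    exact funext hX
  have hH : IsHausdorff ((Ideal.span (Set.range
      (MvPowerSeries.X : Fin d → MvPowerSeries (Fin d) A))).map φ) R := by
    refine IsHausdorff.of_le_jacobson _ _ (le_trans ?_ (maximalIdeal_le_jacobson _))
    rw [hmap, hm]
    exact le_sup_right
  refine surjective_of_mk_map_comp_surjective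
    (I := Ideal.span (Set.range (MvPowerSeries.X : Fin d → MvPowerSeries (Fin d) A))) φ fun z => ?_
  obtain ⟨r, rfl⟩ := Ideal.Quotient.mk_surjective z
  obtain ⟨a, ha⟩ := algebraMap_quotient_span_surjective hπ hres hm (Ideal.Quotient.mk _ r)
  refine ⟨MvPowerSeries.C a, ?_⟩
  rw [RingHom.comp_apply, hC, Ideal.Quotient.eq, hmap]
  exact Ideal.Quotient.eq.mp ha

theorem height_comap_maximalIdeal_le [IsNoetherianRing A]
    (hmA : maximalIdeal A = Ideal.span {π})
    {φ : MvPowerSeries (Fin d) A →+* R} (hC : ∀ a, φ (MvPowerSeries.C a) = algebraMap A R a)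
    (hX : ∀ i, φ (MvPowerSeries.X i) ∈ maximalIdeal R) :
    ((maximalIdeal R).comap φ).height ≤ (d + 1 : ℕ) := by
  classical
  let s : Finset (MvPowerSeries (Fin d) A) :=
    insert (MvPowerSeries.C π) (Finset.univ.image MvPowerSeries.X)
  have hXs : Ideal.span (Set.range MvPowerSeries.X) ≤
      Ideal.span (s : Set (MvPowerSeries (Fin d) A)) := by
    refine Ideal.span_mono ?_
    rintro _ ⟨i, rfl⟩
    simp [s]
  have hspan : (maximalIdeal R).comap φ = Ideal.span (s : Set (MvPowerSeries (Fin d) A)) := by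
    refine le_antisymm (fun f hf => ?_) (Ideal.span_le.mpr ?_)
    · have hdiff : f - MvPowerSeries.C (MvPowerSeries.constantCoeff f) ∈
          Ideal.span (Set.range MvPowerSeries.X) :=
        MvPowerSeries.mem_span_range_X (by simp)
      have hφ : φ (f - MvPowerSeries.C (MvPowerSeries.constantCoeff f)) ∈ maximalIdeal R := by
        have : Ideal.span (Set.range MvPowerSeries.X) ≤ (maximalIdeal R).comap φ := by
          rw [Ideal.span_le]
          rintro _ ⟨i, rfl⟩
          exact hX i
        exact this hdiff
      have hc : MvPowerSeries.constantCoeff f ∈ maximalIdeal A := by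
        rw [← maximalIdeal_comap (algebraMap A R), Ideal.mem_comap, ← hC]
        have := (maximalIdeal R).sub_mem hf hφ
        rwa [← map_sub, sub_sub_cancel] at this
      rw [hmA] at hc
      obtain ⟨c, hc⟩ := Ideal.mem_span_singleton'.mp hc
      have hCmem : MvPowerSeries.C (MvPowerSeries.constantCoeff f) ∈
          Ideal.span (s : Set (MvPowerSeries (Fin d) A)) := by
        rw [← hc, map_mul]
        exact Ideal.mul_mem_left _ _ (Ideal.subset_span (by simp [s]))
      have := Ideal.add_mem _ (hXs hdiff) hCmem
      rwa [sub_add_cancel] at this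
    · intro f hf
      simp only [s, Finset.coe_insert, Finset.coe_image, Finset.coe_univ, Set.image_univ,
        Set.mem_insert_iff, Set.mem_range] at hf
      rcases hf with rfl | ⟨i, rfl⟩
      · change φ _ ∈ maximalIdeal R
        rw [hC]
        have : π ∈ maximalIdeal A := hmA ▸ Ideal.mem_span_singleton_self π
        rwa [← maximalIdeal_comap (algebraMap A R)] at this
      · exact hX i
  have hp : ((maximalIdeal R).comap φ).IsPrime := Ideal.comap_isPrime _ _
  have hmin : (maximalIdeal R).comap φ ∈
      (Ideal.span (s : Set (MvPowerSeries (Fin d) A))).minimalPrimes := by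
    rw [← hspan, Ideal.minimalPrimes_eq_subsingleton_self]
    exact Set.mem_singleton _
  refine (Ideal.height_le_card_of_mem_minimalPrimes_span_finset hmin).trans ?_
  have h1 : s.card ≤ d + 1 := by
    refine (Finset.card_insert_le _ _).trans (Nat.succ_le_succ ?_)
    exact Finset.card_image_le.trans (by simp)
  exact_mod_cast h1

end

/-! ### The conormal map -/

/-- For a `d`-column matrix `G` over `R`, the homomorphism `R[T₁, …, T_d] → R[λ₁, …, λ_m]` of
polynomial rings sending `T_i` to the linear form `∑ⱼ G_{ji} λⱼ`. For `R = S / (f₁, …, f_m)` and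
`G` the Jacobian matrix of the `fⱼ` its kernel consists of the equations satisfied by all conormal
vectors of `Spec R` in `Spec S`. -/
noncomputable def conormalMap {R : Type*} [CommRing R] {m d : ℕ} (G : Fin m → Fin d → R) :
    MvPolynomial (Fin d) R →ₐ[R] MvPolynomial (Fin m) R :=
  MvPolynomial.aeval fun i => ∑ j, MvPolynomial.C (G j i) * MvPolynomial.X j

theorem conormalMap_X {R : Type*} [CommRing R] {m d : ℕ} (G : Fin m → Fin d → R) (i : Fin d) :
    conormalMap G (MvPolynomial.X i) = ∑ j, MvPolynomial.C (G j i) * MvPolynomial.X j :=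
  MvPolynomial.aeval_X _ _

theorem conormalMap_C {R : Type*} [CommRing R] {m d : ℕ} (G : Fin m → Fin d → R) (r : R) :
    conormalMap G (MvPolynomial.C r) = MvPolynomial.C r :=
  MvPolynomial.aeval_C _ _

/-- The kernel of the conormal map contains `d - rank G` independent linear forms. -/
theorem le_rank_add_height_ker_conormalMap {R : Type*} [CommRing R] [IsDomain R] [CharZero R]
    {m d : ℕ} (G : Fin m → Fin d → R) :
    (d : ℕ∞) ≤ ((Matrix.of G).map (algebraMap R (FractionRing R))).rank +
      (RingHom.ker (conormalMap G)).height := by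
  classical
  set W : Matrix (Fin m) (Fin d) (FractionRing R) :=
    (Matrix.of G).map (algebraMap R (FractionRing R)) with hW
  set h := Module.finrank (FractionRing R) (LinearMap.ker W.mulVecLin) with hh
  have hd : W.rank + h = d := by
    have := W.mulVecLin.finrank_range_add_finrank_ker
    simpa [Matrix.rank] using this
  -- a basis of the kernel of the matrix, with denominators cleared
  let b := Module.finBasis (FractionRing R) (LinearMap.ker W.mulVecLin)
  obtain ⟨t, ht⟩ := IsLocalization.exist_integer_multiples_of_finite (nonZeroDivisors R)
    (fun kl : Fin h × Fin d => (b kl.1 : Fin d → FractionRing R) kl.2)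
  choose a ha using ht
  have ha' : ∀ k l, algebraMap R (FractionRing R) (a (k, l)) =
      algebraMap R (FractionRing R) t * (b k : Fin d → FractionRing R) l := fun k l => by
    rw [ha, Algebra.smul_def]
  have ht0 : algebraMap R (FractionRing R) t ≠ 0 := by
    simp
  let w : Fin h → Fin d → FractionRing R := fun k l => algebraMap R (FractionRing R) (a (k, l))
  have hw : LinearIndependent (FractionRing R) w := by
    have h1 : LinearIndependent (FractionRing R)
        (fun k => (b k : Fin d → FractionRing R)) :=
      b.linearIndependent.map' (LinearMap.ker W.mulVecLin).subtype (Submodule.ker_subtype _)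
    have h2 := h1.units_smul (fun _ => Units.mk0 _ ht0)
    convert h2 using 1
    ext k l
    simp only [w, ha', Pi.smul_apply', Pi.smul_apply]
    rfl
  have hker : ∀ k j, ∑ l, a (k, l) * G j l = 0 := fun k j => by
    apply IsFractionRing.injective R (FractionRing R)
    have h1 := congrFun (LinearMap.mem_ker.mp (b k).2) j
    simp only [Matrix.mulVecLin_apply, Matrix.mulVec, dotProduct, Pi.zero_apply, hW,
      Matrix.map_apply, Matrix.of_apply] at h1
    rw [map_sum, map_zero]
    calc _ = algebraMap R (FractionRing R) t * ∑ l, algebraMap R (FractionRing R) (G j l) *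
            (b k : Fin d → FractionRing R) l := by
          rw [Finset.mul_sum]
          refine Finset.sum_congr rfl fun l _ => ?_
          rw [map_mul, ha']
          ring
      _ = 0 := by rw [h1, mul_zero]
  obtain ⟨c, u, hu, hcu⟩ := hw.exists_dual (R := R)
  have hcu' : ∀ i j, ∑ l, c i l * a (j, l) = if i = j then u else 0 := fun i j => by
    apply IsFractionRing.injective R (FractionRing R)
    rw [map_sum]
    simp only [map_mul]
    rw [hcu i j, apply_ite (algebraMap R (FractionRing R)), map_zero]
  let L : Fin h → MvPolynomial (Fin d) R := fun k =>
    ∑ l, MvPolynomial.C (a (k, l)) * MvPolynomial.X l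
  choose D hD using fun i : Fin h => Derivation.exists_int_sum_smul
    (fun l => MvPolynomial.C (c i l)) (MvPolynomial.pderiv : Fin d → _)
  have hC : ∀ r : R, r ≠ 0 → MvPolynomial.C r ∉ RingHom.ker (conormalMap G) := fun r hr h0 => by
    rw [RingHom.mem_ker, conormalMap_C, MvPolynomial.C_eq_zero] at h0
    exact hr h0
  have hprime : (RingHom.ker (conormalMap G)).IsPrime := RingHom.ker_isPrime (conormalMap G)
  have := Ideal.le_height_of_det_notMem (RingHom.ker (conormalMap G))
    (fun n hn => by
      have := hC (n : R) (Nat.cast_ne_zero.mpr hn)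
      rwa [map_natCast] at this) L
    (fun k => by
      simp only [L, RingHom.mem_ker, map_sum, map_mul, conormalMap_C, conormalMap_X,
        Finset.mul_sum]
      rw [Finset.sum_comm]
      refine Finset.sum_eq_zero fun j _ => ?_
      have h1 := congrArg (fun r => MvPolynomial.C r * MvPolynomial.X j) (hker k j)
      simp only [map_sum, map_zero, zero_mul, Finset.sum_mul, map_mul] at h1
      rw [← h1]
      exact Finset.sum_congr rfl fun l _ => (mul_assoc _ _ _).symm)
    D
    (by
      have hmat : (Matrix.of fun i j => D i (L j)) =
          Matrix.diagonal fun _ => MvPolynomial.C u := by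
        ext1 i j
        rw [Matrix.of_apply, Matrix.diagonal_apply]
        refine (hD i (L j)).trans ?_
        have h1 : ∀ l, MvPolynomial.pderiv l (L j) = MvPolynomial.C (a (j, l)) := fun l => by
          simp [L, MvPolynomial.pderiv_X, Pi.single_apply]
        have h2 := congrArg (MvPolynomial.C (σ := Fin d)) (hcu' i j)
        rw [map_sum, apply_ite MvPolynomial.C, map_zero] at h2
        rw [← h2]
        refine Finset.sum_congr rfl fun l _ => ?_
        rw [h1, map_mul]
      intro h0
      have h1 := congrArg Matrix.det hmat
      rw [Matrix.det_diagonal, Finset.prod_const, ← map_pow] at h1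
      exact hC _ (pow_ne_zero _ hu) (Set.mem_of_eq_of_mem h1.symm h0))
  calc (d : ℕ∞) = ((W.rank + h : ℕ) : ℕ∞) := congrArg _ hd.symm
    _ = W.rank + h := Nat.cast_add _ _
    _ ≤ _ := by gcongr

/-- The rank of the Jacobian matrix at the generic point is at most the codimension. -/
theorem rank_le_height_ker {S R : Type*} [CommRing S] [CommRing R] [IsDomain R] [CharZero R]
    {m d : ℕ} {φ : S →+* R} (hφ : Function.Surjective φ) (f : Fin m → S) (hf : ∀ j, φ (f j) = 0)
    (D : Fin d → Derivation ℤ S S) :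
    (((Matrix.of fun j i => φ (D i (f j))).map (algebraMap R (FractionRing R))).rank : ℕ∞) ≤
      (RingHom.ker φ).height := by
  classical
  set W : Matrix (Fin m) (Fin d) (FractionRing R) :=
    (Matrix.of fun j i => φ (D i (f j))).map (algebraMap R (FractionRing R)) with hW
  obtain ⟨g, hg, -, hli⟩ :=
    Submodule.exists_fun_fin_finrank_span_eq (FractionRing R) (Set.range W.row)
  rw [Matrix.rank_eq_finrank_span_row]
  choose e he using hg
  obtain ⟨c, u, hu, hcu⟩ := hli.exists_dual (R := R)
  have hcu' : ∀ i j, ∑ l, c i l * φ (D l (f (e j))) = if i = j then u else 0 := fun i j => by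
    apply IsFractionRing.injective R (FractionRing R)
    rw [map_sum, apply_ite (algebraMap R (FractionRing R)), map_zero, ← hcu i j]
    refine Finset.sum_congr rfl fun l _ => ?_
    rw [map_mul, ← he]
    rfl
  choose c' hc' using fun i l => hφ (c i l)
  have hprime : (RingHom.ker φ).IsPrime := RingHom.ker_isPrime φ
  refine Ideal.le_height_of_det_notMem (RingHom.ker φ) (fun n hn => ?_) (fun j => f (e j))
    (fun j => hf _) (fun i => ∑ l, c' i l • D l) ?_
  · rw [RingHom.mem_ker, map_natCast]
    exact Nat.cast_ne_zero.mpr hn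
  · rw [RingHom.mem_ker, RingHom.map_det]
    have hmat : φ.mapMatrix (Matrix.of fun i j => (∑ l, c' i l • D l) (f (e j))) =
        Matrix.diagonal fun _ => u := by
      ext i j
      rw [Matrix.diagonal_apply, ← hcu' i j]
      refine (congrArg φ (Derivation.sum_smul_apply _ _ _)).trans ?_
      rw [map_sum]
      refine Finset.sum_congr rfl fun l _ => ?_
      rw [map_mul, hc']
    rw [hmat, Matrix.det_diagonal, Finset.prod_const]
    exact pow_ne_zero _ hu

/-- The Jacobian matrix of power series `f₁, …, f_m`, with entries mapped to a quotient `R` of the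
power series ring. -/
noncomputable def jacobian {A R : Type*} [CommRing A] [CommRing R] {m d : ℕ}
    (φ : MvPowerSeries (Fin d) A →+* R) (f : Fin m → MvPowerSeries (Fin d) A) :
    Fin m → Fin d → R :=
  fun j i => φ (MvPowerSeries.pderiv A i (f j))

theorem Derivation.exists_int {A S : Type*} [CommRing A] [CommRing S] [Algebra A S]
    (D : Derivation A S S) : ∃ D' : Derivation ℤ S S, ∀ a, D' a = D a :=
  ⟨D.restrictScalars ℤ, fun _ => rfl⟩

/-- The conormal variety in `Spec S × 𝔸ᵈ`, cut out by `ker φ` and the kernel of the conormal map,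
has codimension at least `d`, as for conormal varieties in general: if the Jacobian matrix has
rank `r`, the two heights are at least `r` and `d - r`. -/
theorem le_height_ker_add_height_ker_conormalMap {A R : Type*} [CommRing A] [CommRing R]
    [IsDomain R] [CharZero R] {m d : ℕ} {φ : MvPowerSeries (Fin d) A →+* R}
    (hφ : Function.Surjective φ) (f : Fin m → MvPowerSeries (Fin d) A) (hf : ∀ j, φ (f j) = 0) :
    (d : ℕ∞) ≤ (RingHom.ker φ).height + (RingHom.ker (conormalMap (jacobian φ f))).height := by
  choose D hD using fun i : Fin d => Derivation.exists_int (MvPowerSeries.pderiv A i)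
  have h1 := le_rank_add_height_ker_conormalMap (jacobian φ f)
  have h2 := rank_le_height_ker hφ f hf D
  have h3 : (fun j i => φ (D i (f j))) = jacobian φ f := by
    ext j i
    rw [hD, jacobian]
  rw [h3] at h2
  exact h1.trans (by gcongr)

/-- If `∑ vᵢ Xᵢ` vanishes to order two along `Spec R` at the point `p`, that is, it lies in the
second symbolic power of `p`, then `v` is a conormal vector at `p`: modulo `p` it is, up to a unit
of `R_p`, a combination of the rows of the Jacobian matrix. -/
theorem exists_sum_jacobian_of_mem_symbolicPower {A R : Type*} [CommRing A] [CommRing R]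
    [Algebra A R] {m d : ℕ} {φ : MvPowerSeries (Fin d) A →+* R} (hφ : Function.Surjective φ)
    (hC : ∀ a, φ (MvPowerSeries.C a) = algebraMap A R a) {f : Fin m → MvPowerSeries (Fin d) A}
    (hf : Ideal.span (Set.range f) = RingHom.ker φ) (p : Ideal R) [p.IsPrime] (v : Fin d → A)
    (hv : ∑ i, algebraMap A R (v i) * φ (MvPowerSeries.X i) ∈ symbolicPower p 2) :
    ∑ i, algebraMap A R (v i) * φ (MvPowerSeries.X i) ∈ p ∧
      ∃ s ∉ p, ∃ h : Fin m → R,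
        ∀ i, s * algebraMap A R (v i) - ∑ j, h j * jacobian φ f j i ∈ p := by
  classical
  set y : R := ∑ i, algebraMap A R (v i) * φ (MvPowerSeries.X i) with hy
  obtain ⟨s, hs, hsy⟩ : ∃ s ∉ p, s * y ∈ p ^ 2 := by
    obtain ⟨⟨a, s⟩, h1⟩ := (IsLocalization.mem_map_algebraMap_iff p.primeCompl _).mp hv
    rw [← map_mul, IsLocalization.eq_iff_exists p.primeCompl] at h1
    obtain ⟨c, hc⟩ := h1
    refine ⟨c * s, (c * s).2, ?_⟩
    have h2 : (c : R) * s * y = c * a := by rw [← hc]; ring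
    rw [h2]
    exact Ideal.mul_mem_left _ _ a.2
  have hyp : y ∈ p := (‹p.IsPrime›.mem_or_mem (Ideal.pow_le_self two_ne_zero hsy)).resolve_left hs
  refine ⟨hyp, ?_⟩
  obtain ⟨s', rfl⟩ := hφ s
  let Y : MvPowerSeries (Fin d) A := ∑ i, MvPowerSeries.C (v i) * MvPowerSeries.X i
  have hY : φ Y = y := by simp [Y, hy, hC]
  have hDY : ∀ i, MvPowerSeries.pderiv A i Y = MvPowerSeries.C (v i) := fun i => by
    simp only [Y, map_sum, Derivation.leibniz, MvPowerSeries.pderiv_C, MvPowerSeries.pderiv_X,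
      smul_eq_mul]
    simp [Pi.single_apply]
  obtain ⟨g, hg, hgs⟩ : ∃ g ∈ p.comap φ * p.comap φ, φ g = φ s' * y := by
    have hsq : (p.comap φ * p.comap φ).map φ = p ^ 2 := by
      rw [Ideal.map_mul, Ideal.map_comap_of_surjective φ hφ, pow_two]
    rw [← hsq] at hsy
    exact (Ideal.mem_map_iff_of_surjective φ hφ).mp hsy
  have hker : s' * Y - g ∈ Ideal.span (Set.range f) := by
    rw [hf, RingHom.mem_ker, map_sub, map_mul, hY, hgs, sub_self]
  obtain ⟨h, hh⟩ := (Ideal.mem_span_range_iff_exists_fun).mp hker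
  have hfk : ∀ j, φ (f j) = 0 := fun j => by
    rw [← RingHom.mem_ker, ← hf]
    exact Ideal.subset_span ⟨j, rfl⟩
  -- a derivation maps the square of an ideal into the ideal
  have hDg : ∀ i, φ (MvPowerSeries.pderiv A i g) ∈ p := by
    intro i
    refine Submodule.mul_induction_on hg (C := fun z => φ (MvPowerSeries.pderiv A i z) ∈ p)
      (fun a ha b hb => ?_) fun a b ha hb => ?_
    · rw [Derivation.leibniz, map_add, smul_eq_mul, map_mul, smul_eq_mul, map_mul]
      exact p.add_mem (p.mul_mem_right _ ha) (p.mul_mem_right _ hb)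
    · rw [map_add, map_add]
      exact p.add_mem ha hb
  refine ⟨φ s', hs, fun j => φ (h j), fun i => ?_⟩
  have h1 := congrArg (fun z => φ (MvPowerSeries.pderiv A i z)) hh
  simp only [map_sum, map_sub, Derivation.leibniz, hDY, smul_eq_mul, map_add, map_mul, hfk, hY,
    zero_mul, add_zero, hC] at h1
  have h2 : φ s' * algebraMap A R (v i) - ∑ j, φ (h j) * jacobian φ f j i =
      φ (MvPowerSeries.pderiv A i g) - y * φ (MvPowerSeries.pderiv A i s') := by
    simp only [jacobian]
    linear_combination -h1
  rw [h2]
  exact p.sub_mem (hDg i) (p.mul_mem_right _ hyp)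

/-- Conormal vectors satisfy the equations in the kernel of the conormal map. -/
theorem exists_ringHom_residueField_conormalMap {R : Type*} [CommRing R] {m d : ℕ}
    (G : Fin m → Fin d → R) (p : Ideal R) [p.IsPrime] (v : Fin d → R) {s : R} (hs : s ∉ p)
    (h : Fin m → R) (hv : ∀ i, s * v i - ∑ j, h j * G j i ∈ p) :
    ∃ Θ : MvPolynomial (Fin m) R →+* p.ResidueField,
      (∀ r, Θ (MvPolynomial.C r) = algebraMap R _ r) ∧
      ∀ g, Θ (conormalMap G g) = algebraMap R _ (MvPolynomial.eval v g) := by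
  have hs0 : algebraMap R p.ResidueField s ≠ 0 := by
    rwa [Ne, Ideal.algebraMap_residueField_eq_zero]
  let Θ : MvPolynomial (Fin m) R →+* p.ResidueField :=
    MvPolynomial.eval₂Hom (algebraMap R p.ResidueField)
      fun j => algebraMap R p.ResidueField (h j) / algebraMap R p.ResidueField s
  have hΘC : ∀ r, Θ (MvPolynomial.C r) = algebraMap R _ r := fun r =>
    MvPolynomial.eval₂Hom_C _ _ _
  have hΘX : ∀ j, Θ (MvPolynomial.X j) =
      algebraMap R p.ResidueField (h j) / algebraMap R p.ResidueField s := fun j =>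
    MvPolynomial.eval₂Hom_X' _ _ _
  refine ⟨Θ, hΘC, fun g => ?_⟩
  have hhom : Θ.comp (conormalMap G).toRingHom =
      (algebraMap R p.ResidueField).comp (MvPolynomial.eval v) := by
    refine MvPolynomial.ringHom_ext (fun r => ?_) fun i => ?_
    · have : (conormalMap G).toRingHom (MvPolynomial.C r) = MvPolynomial.C r := conormalMap_C _ r
      rw [RingHom.comp_apply, this, hΘC, RingHom.comp_apply, MvPolynomial.eval_C]
    · have : (conormalMap G).toRingHom (MvPolynomial.X i) = _ := conormalMap_X _ i
      rw [RingHom.comp_apply, this, RingHom.comp_apply, MvPolynomial.eval_X]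
      have h1 := Ideal.algebraMap_residueField_eq_zero.mpr (hv i)
      rw [map_sub, map_sum, map_mul, sub_eq_zero] at h1
      simp only [map_sum, map_mul, hΘC, hΘX]
      apply mul_left_cancel₀ hs0
      rw [h1, Finset.mul_sum]
      refine Finset.sum_congr rfl fun j _ => ?_
      rw [map_mul, ← mul_div_assoc, mul_div_assoc']
      field_simp
  exact RingHom.congr_fun hhom g

/-! ### The Euler derivation -/

theorem Derivation.apply_add_eq_zero {O : Type*} [CommRing O] (E : Derivation ℤ O O) {a b : O}
    (ha : E a = 0) (hb : E b = 0) : E (a + b) = 0 := by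
  rw [map_add, ha, hb, add_zero]

theorem Derivation.apply_mul_eq_zero {O : Type*} [CommRing O] (E : Derivation ℤ O O) {a b : O}
    (ha : E a = 0) (hb : E b = 0) : E (a * b) = 0 := by
  rw [E.leibniz, ha, hb, smul_zero, smul_zero, add_zero]

theorem Derivation.apply_eq_zero_of_mul_eq {O : Type*} [CommRing O] (E : Derivation ℤ O O)
    {a b c : O} (hb : IsUnit b) (h : c * b = a) (hEb : E b = 0) (hEa : E a = 0) : E c = 0 := by
  rw [← h, E.leibniz, hEb, smul_zero, zero_add, smul_eq_mul] at hEa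
  exact hb.mul_right_eq_zero.mp hEa

/-- The localization of `P` at `M` satisfies the hypotheses of
`Derivation.eq_zero_of_apply_eq_self_of_isLocalRing`: by `hmin` its maximal ideal is the radical of
`π`. -/
theorem Derivation.eq_zero_of_apply_eq_self_of_isPrime {P : Type*} [CommRing P] [IsDomain P]
    [CharZero P] [IsNoetherianRing P] (D : Derivation ℤ P P) (M : Ideal P) [M.IsPrime] {π : P}
    (hπ : D π = 0) (hmem : π ∈ M) (hmin : ∀ q : Ideal P, q.IsPrime → q ≤ M → π ∈ q → q = M)
    (hres : ∀ z, ∃ c, D c = 0 ∧ z - c ∈ M) {x : P} (hx : D x = x) : x = 0 := by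
  have hinj := IsLocalization.injective (Localization.AtPrime M) M.primeCompl_le_nonZeroDivisors
  have hdom : IsDomain (Localization.AtPrime M) :=
    IsLocalization.isDomain_localization M.primeCompl_le_nonZeroDivisors
  have hchar : CharZero (Localization.AtPrime M) := charZero_of_injective_algebraMap hinj
  obtain ⟨E, hE⟩ := Derivation.exists_isLocalization (K := Localization.AtPrime M) M.primeCompl D
  have hmap : ∀ z, algebraMap P (Localization.AtPrime M) z ∈ maximalIdeal _ ↔ z ∈ M := fun z =>
    IsLocalization.AtPrime.to_map_mem_maximal_iff _ M z
  apply hinj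
  rw [map_zero]
  refine E.eq_zero_of_apply_eq_self_of_isLocalRing (π := algebraMap P _ π)
    (by rw [hE, hπ, map_zero])
    ((hmap π).mpr hmem) ?_ (fun z => ?_) (by rw [hE, hx])
  · refine Ideal.exists_pow_le_of_le_radical_of_fg ?_ (IsNoetherian.noetherian _)
    rw [Ideal.radical_eq_sInf]
    refine le_sInf fun q ⟨hq, hqp⟩ => ?_
    have h1 : q.comap (algebraMap P _) = M := by
      refine hmin _ (hqp.comap _) ?_ (hq (Ideal.mem_span_singleton_self _))
      intro z hz
      exact (hmap z).mp (le_maximalIdeal hqp.ne_top hz)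
    rw [← Localization.AtPrime.map_eq_maximalIdeal, Ideal.map_le_iff_le_comap, h1]
  · obtain ⟨a, s, rfl⟩ := IsLocalization.exists_mk'_eq M.primeCompl z
    obtain ⟨a', ha', ha⟩ := hres a
    obtain ⟨s', hs', hs⟩ := hres s
    have hs'M : s' ∉ M := fun h => s.2 (by simpa using M.add_mem hs h)
    set ι := algebraMap P (Localization.AtPrime M)
    set y := IsLocalization.mk' (Localization.AtPrime M) a s
    set c := IsLocalization.mk' (Localization.AtPrime M) a' (⟨s', hs'M⟩ : M.primeCompl)
    have hy : y * ι s = ι a := IsLocalization.mk'_spec _ _ _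
    have hc : c * ι s' = ι a' := IsLocalization.mk'_spec _ _ (⟨s', hs'M⟩ : M.primeCompl)
    have hu' : IsUnit (ι s') :=
      IsLocalization.map_units (Localization.AtPrime M) (⟨s', hs'M⟩ : M.primeCompl)
    have hu : IsUnit (ι s) := IsLocalization.map_units (Localization.AtPrime M) s
    refine ⟨c, ?_, ?_⟩
    · exact E.apply_eq_zero_of_mul_eq hu' hc (by rw [hE, hs', map_zero]) (by rw [hE, ha', map_zero])
    · refine (Ideal.unit_mul_mem_iff_mem _ hu).mp ?_
      have h1 : ι s * (y - c) = ι (a - a') - c * ι (s - s') := by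
        rw [map_sub, map_sub, ← hy, ← hc]
        ring
      rw [h1]
      exact Ideal.sub_mem _ ((hmap _).mpr ha) (Ideal.mul_mem_left _ _ ((hmap _).mpr hs))

/-- `Derivation.eq_zero_of_apply_eq_self_of_isPrime` for the derivation induced on `P ⧸ J`. -/
theorem Derivation.mem_of_apply_sub_mem {P : Type*} [CommRing P] [IsNoetherianRing P]
    (D : Derivation ℤ P P) (J M : Ideal P) [J.IsPrime] [M.IsPrime] (hJM : J ≤ M)
    (hchar : ∀ n : ℕ, n ≠ 0 → (n : P) ∉ J) (hD : ∀ a ∈ J, D a ∈ J) {π : P} (hπ : D π = 0)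
    (hmem : π ∈ M) (hmin : ∀ q : Ideal P, q.IsPrime → J ≤ q → q ≤ M → π ∈ q → q = M)
    (hres : ∀ z, ∃ c, D c = 0 ∧ z - c ∈ M) {x : P} (hx : D x - x ∈ J) : x ∈ J := by
  have hsurj : Function.Surjective (Ideal.Quotient.mk J) := Ideal.Quotient.mk_surjective
  obtain ⟨D', hD'⟩ := Derivation.exists_of_surjective hsurj D fun a ha => by
    rw [Ideal.mk_ker] at ha ⊢
    exact hD a ha
  have hker : RingHom.ker (Ideal.Quotient.mk J) ≤ M := by rwa [Ideal.mk_ker]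
  have hprime : (M.map (Ideal.Quotient.mk J)).IsPrime := Ideal.map_isPrime_of_surjective hsurj hker
  have hcomap : (M.map (Ideal.Quotient.mk J)).comap (Ideal.Quotient.mk J) = M := by
    rw [Ideal.comap_map_of_surjective' _ hsurj, sup_eq_left.mpr hker]
  have hchar' : CharZero (P ⧸ J) := by
    refine charZero_of_inj_zero fun n hn => ?_
    by_contra h0
    refine hchar n h0 (Ideal.Quotient.eq_zero_iff_mem.mp ?_)
    rwa [_root_.map_natCast]
  rw [← Ideal.Quotient.eq_zero_iff_mem]
  refine D'.eq_zero_of_apply_eq_self_of_isPrime (M.map (Ideal.Quotient.mk J))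
    (π := Ideal.Quotient.mk J π) (by rw [hD', hπ, map_zero]) (Ideal.mem_map_of_mem _ hmem)
    (fun q hq hqM hπq => ?_) (fun z => ?_) ?_
  · have h1 := hmin (q.comap (Ideal.Quotient.mk J)) (hq.comap _)
      (fun a ha => by
        rw [Ideal.mem_comap, Ideal.Quotient.eq_zero_iff_mem.mpr ha]
        exact q.zero_mem)
      ((Ideal.comap_mono hqM).trans hcomap.le) hπq
    rw [← h1, Ideal.map_comap_of_surjective _ hsurj]
  · obtain ⟨z, rfl⟩ := hsurj z
    obtain ⟨c, hc, hz⟩ := hres z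
    refine ⟨Ideal.Quotient.mk J c, by rw [hD', hc, map_zero], ?_⟩
    rw [← map_sub]
    exact Ideal.mem_map_of_mem _ hz
  · rw [hD', ← sub_eq_zero, ← map_sub]
    exact Ideal.Quotient.eq_zero_iff_mem.mpr hx

theorem MvPowerSeries.pderiv_comm {σ A : Type*} [CommRing A] (i j : σ) (f : MvPowerSeries σ A) :
    MvPowerSeries.pderiv A i (MvPowerSeries.pderiv A j f) =
      MvPowerSeries.pderiv A j (MvPowerSeries.pderiv A i f) := by
  classical
  rcases eq_or_ne i j with rfl | hij
  · rfl
  ext n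
  simp only [MvPowerSeries.coeff_pderiv, Finsupp.add_apply, Finsupp.single_eq_of_ne hij,
    Finsupp.single_eq_of_ne hij.symm, add_zero]
  rw [add_right_comm]
  ring

/-- If every conormal vector of `Spec R` annihilates the vector `(x₁, …, x_d)`, then the Euler
derivation `∑ xᵢ ∂/∂xᵢ` exists on `R`; it is extended to `R[T₁, …, T_d]` by zero on the variables,
and lifted to `R[λ₁, …, λ_m]` so as to be compatible with the conormal map. -/
theorem exists_euler_derivation {A R : Type*} [CommRing A] [CommRing R] [Algebra A R]
    {m d : ℕ} {φ : MvPowerSeries (Fin d) A →+* R} (hφ : Function.Surjective φ)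
    (hC : ∀ a, φ (MvPowerSeries.C a) = algebraMap A R a) {f : Fin m → MvPowerSeries (Fin d) A}
    (hf : Ideal.span (Set.range f) = RingHom.ker φ)
    (hx : ∀ j, ∑ i, φ (MvPowerSeries.X i) * jacobian φ f j i = 0) :
    ∃ D : Derivation ℤ (MvPolynomial (Fin d) R) (MvPolynomial (Fin d) R),
      (∀ a, D (MvPolynomial.C (algebraMap A R a)) = 0) ∧ (∀ i, D (MvPolynomial.X i) = 0) ∧
      (∀ i, D (MvPolynomial.C (φ (MvPowerSeries.X i))) = MvPolynomial.C (φ (MvPowerSeries.X i))) ∧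
      ∀ g ∈ RingHom.ker (conormalMap (jacobian φ f)),
        D g ∈ RingHom.ker (conormalMap (jacobian φ f)) := by
  classical
  obtain ⟨E, hE⟩ := Derivation.exists_int_sum_smul
    (MvPowerSeries.X : Fin d → MvPowerSeries (Fin d) A) (MvPowerSeries.pderiv A)
  have hfk : ∀ j, φ (f j) = 0 := fun j => by
    rw [← RingHom.mem_ker, ← hf]
    exact Ideal.subset_span ⟨j, rfl⟩
  have hEf : ∀ j, E (f j) ∈ RingHom.ker φ := fun j => by
    rw [RingHom.mem_ker, hE, map_sum]
    simp only [map_mul]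
    exact hx j
  have hEker : ∀ a ∈ RingHom.ker φ, E a ∈ RingHom.ker φ := by
    rw [← hf] at hEf ⊢
    exact Derivation.apply_mem_span E (Set.forall_mem_range.mpr hEf)
  obtain ⟨E', hE'⟩ := Derivation.exists_of_surjective hφ E hEker
  have hEC : ∀ a, E (MvPowerSeries.C a) = 0 := fun a => by simp [hE]
  have hEX : ∀ i, E (MvPowerSeries.X i) = MvPowerSeries.X i := fun i => by
    rw [hE]
    simp [MvPowerSeries.pderiv_X, Pi.single_apply]
  have hlin : ∀ j, ∃ h : Fin m → MvPowerSeries (Fin d) A, ∑ l, h l * f l = E (f j) := fun j => by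
    have h1 := hEf j
    rwa [← hf, Ideal.mem_span_range_iff_exists_fun] at h1
  choose h hh using hlin
  -- the Euler derivation lowers the degree of a derivative by one
  have hEG : ∀ j i, E' (jacobian φ f j i) =
      ∑ l, φ (h j l) * jacobian φ f l i - jacobian φ f j i := by
    intro j i
    have h1 : E (MvPowerSeries.pderiv A i (f j)) =
        MvPowerSeries.pderiv A i (E (f j)) - MvPowerSeries.pderiv A i (f j) := by
      rw [hE, hE, map_sum]
      simp only [Derivation.leibniz, MvPowerSeries.pderiv_X, smul_eq_mul, Finset.sum_add_distrib,
        MvPowerSeries.pderiv_comm i]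
      simp [Pi.single_apply]
    simp only [jacobian]
    rw [hE', h1, ← hh, map_sub, map_sum, map_sum]
    simp only [Derivation.leibniz, smul_eq_mul, map_add, map_mul, hfk, zero_mul, add_zero]
  obtain ⟨D, hDC, hDX⟩ := Derivation.exists_mvPolynomial E' (fun _ : Fin d => 0)
  obtain ⟨D', hDC', hDX'⟩ := Derivation.exists_mvPolynomial E' (fun l : Fin m =>
    MvPolynomial.X l - ∑ k, MvPolynomial.X k * MvPolynomial.C (φ (h k l)))
  have hDt : ∀ i, D' (conormalMap (jacobian φ f) (MvPolynomial.X i)) = 0 := by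
    intro i
    rw [conormalMap_X]
    refine (map_sum D' _ _).trans ?_
    have h1 : ∀ j, D' (MvPolynomial.C (jacobian φ f j i) * MvPolynomial.X j) =
        ∑ l, MvPolynomial.X j * MvPolynomial.C (φ (h j l)) * MvPolynomial.C (jacobian φ f l i) -
        ∑ k, MvPolynomial.X k * MvPolynomial.C (φ (h k j)) *
          MvPolynomial.C (jacobian φ f j i) := by
      intro j
      refine (D'.leibniz _ _).trans ?_
      rw [hDX', hDC', hEG]
      simp only [smul_eq_mul, map_sub, map_sum, map_mul, mul_sub, Finset.mul_sum]
      have h2 : ∀ k, MvPolynomial.C (jacobian φ f j i) *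
          (MvPolynomial.X k * MvPolynomial.C (φ (h k j))) =
          MvPolynomial.X k * MvPolynomial.C (φ (h k j)) * MvPolynomial.C (jacobian φ f j i) :=
        fun k => mul_comm _ _
      simp only [h2, mul_assoc]
      ring
    rw [Finset.sum_congr rfl fun j _ => h1 j, Finset.sum_sub_distrib, sub_eq_zero,
      Finset.sum_comm]
  have hcomm : ∀ g, conormalMap (jacobian φ f) (D g) = D' (conormalMap (jacobian φ f) g) := by
    intro g
    induction g using MvPolynomial.induction_on with
    | C r => rw [hDC, conormalMap_C, conormalMap_C, hDC']
    | add p q hp hq =>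
      rw [map_add D, map_add, hp, hq, map_add (conormalMap _), map_add D']
    | mul_X p i hp =>
      have h1 := D.leibniz p (MvPolynomial.X i)
      have h2 := D'.leibniz (conormalMap (jacobian φ f) p)
        (conormalMap (jacobian φ f) (MvPolynomial.X i))
      rw [hDt, smul_zero, zero_add] at h2
      rw [hDX, smul_zero, zero_add] at h1
      rw [map_mul (conormalMap _), h2, h1, smul_eq_mul, smul_eq_mul, map_mul, hp]
  refine ⟨D, fun a => ?_, hDX, fun i => ?_, fun g hg => ?_⟩
  · rw [hDC, ← hC, hE', hEC, map_zero, map_zero]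
  · rw [hDC, hE', hEX]
  · rw [RingHom.mem_ker] at hg ⊢
    rw [hcomm, hg, map_zero]

/-- Suppose that every conormal vector of `Spec R` annihilates `(x₁, …, x_d)`, and that there is no
prime strictly between the kernel of the conormal map and the extension of the maximal ideal. Then
the Euler derivation acts on the local ring of `R[T] / ker` at the latter prime, which is a local
domain in which `π` is a parameter annihilated by the derivation and whose residue field is
generated by constants; since the `xᵢ` are eigenvectors with eigenvalue `1`, they vanish. -/
theorem eq_zero_of_sum_mul_jacobian_eq_zero {A R : Type*} [CommRing A] [CommRing R] [IsDomain R]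
    [IsLocalRing R] [IsNoetherianRing R] [CharZero R] [Algebra A R]
    {m d : ℕ} {φ : MvPowerSeries (Fin d) A →+* R} (hφ : Function.Surjective φ)
    (hC : ∀ a, φ (MvPowerSeries.C a) = algebraMap A R a) {f : Fin m → MvPowerSeries (Fin d) A}
    (hf : Ideal.span (Set.range f) = RingHom.ker φ)
    (hx : ∀ j, ∑ i, φ (MvPowerSeries.X i) * jacobian φ f j i = 0)
    (hres : ∀ r, ∃ a, r - algebraMap A R a ∈ maximalIdeal R)
    {π : A} (hπ0 : algebraMap A R π ≠ 0) (hπ : algebraMap A R π ∈ maximalIdeal R)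
    (hle : RingHom.ker (conormalMap (jacobian φ f)) ≤ (maximalIdeal R).map MvPolynomial.C)
    (hmin : ∀ q : Ideal (MvPolynomial (Fin d) R), q.IsPrime →
      RingHom.ker (conormalMap (jacobian φ f)) < q → q ≤ (maximalIdeal R).map MvPolynomial.C →
      q = (maximalIdeal R).map MvPolynomial.C) (i : Fin d) :
    φ (MvPowerSeries.X i) = 0 := by
  obtain ⟨D, hDA, hDT, hDx, hDker⟩ := exists_euler_derivation hφ hC hf hx
  have hM := MvPolynomial.isPrime_map_C (σ := Fin d) (maximalIdeal R)
  have hJ : (RingHom.ker (conormalMap (jacobian φ f))).IsPrime := RingHom.ker_isPrime _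
  have hnot : ∀ r : R, r ≠ 0 →
      MvPolynomial.C r ∉ RingHom.ker (conormalMap (jacobian φ f)) := fun r hr h0 => by
    rw [RingHom.mem_ker, conormalMap_C, MvPolynomial.C_eq_zero] at h0
    exact hr h0
  have hmem : MvPolynomial.C (φ (MvPowerSeries.X i)) ∈
      RingHom.ker (conormalMap (jacobian φ f)) := by
    refine Derivation.mem_of_apply_sub_mem D _ ((maximalIdeal R).map MvPolynomial.C) hle
      (fun n hn => ?_) hDker (hDA π) (Ideal.mem_map_of_mem _ hπ) (fun q hq hJq hqM hπq => ?_)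
      (fun z => ?_) (Set.mem_of_eq_of_mem (sub_eq_zero.mpr (hDx i)) (Ideal.zero_mem _))
    · rw [← map_natCast (MvPolynomial.C (σ := Fin d))]
      exact hnot _ (Nat.cast_ne_zero.mpr hn)
    · exact hmin q hq (lt_of_le_of_ne hJq fun h => hnot _ hπ0 (h ▸ hπq)) hqM
    · -- every polynomial is congruent to one with coefficients in `A`
      induction z using MvPolynomial.induction_on with
      | C r =>
        obtain ⟨a, ha⟩ := hres r
        refine ⟨MvPolynomial.C (algebraMap A R a), hDA a, ?_⟩
        rw [← map_sub]
        exact Ideal.mem_map_of_mem _ ha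
      | add p q hp hq =>
        obtain ⟨c, hc, hcp⟩ := hp
        obtain ⟨c', hc', hcq⟩ := hq
        refine ⟨c + c', D.apply_add_eq_zero hc hc', ?_⟩
        rw [add_sub_add_comm]
        exact Ideal.add_mem _ hcp hcq
      | mul_X p l hp =>
        obtain ⟨c, hc, hcp⟩ := hp
        refine ⟨c * MvPolynomial.X l, D.apply_mul_eq_zero hc (hDT l), ?_⟩
        rw [← sub_mul]
        exact Ideal.mul_mem_right _ _ hcp
  by_contra h0
  exact hnot _ h0 hmem

/-! ### A polynomial vanishing on all conormal vectors at bad points -/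

/-- There is a polynomial over `R`, nonzero modulo the maximal ideal, which vanishes modulo `p` at
every tuple `v` with `∑ vᵢ xᵢ` in the second symbolic power of a prime `p` not containing all
`xᵢ`. -/
theorem exists_polynomial_eval_mem {A R : Type*} [CommRing A] [CommRing R] [IsDomain R]
    [IsLocalRing R] [IsNoetherianRing R] [CharZero R] [Algebra A R] [IsNoetherianRing A]
    {d : ℕ} {φ : MvPowerSeries (Fin d) A →+* R} (hφ : Function.Surjective φ)
    (hC : ∀ a, φ (MvPowerSeries.C a) = algebraMap A R a)
    (hX : ∀ i, φ (MvPowerSeries.X i) ∈ maximalIdeal R)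
    (hres : ∀ r, ∃ a, r - algebraMap A R a ∈ maximalIdeal R)
    (hht : ((maximalIdeal R).comap φ).height ≤ (d + 1 : ℕ))
    {π : A} (hπ0 : algebraMap A R π ≠ 0) (hπ : algebraMap A R π ∈ maximalIdeal R) :
    ∃ g : MvPolynomial (Fin d) R, g ∉ (maximalIdeal R).map MvPolynomial.C ∧
      ∀ p : Ideal R, ∀ _ : p.IsPrime, (∃ i, φ (MvPowerSeries.X i) ∉ p) → ∀ v : Fin d → A,
        ∑ i, algebraMap A R (v i) * φ (MvPowerSeries.X i) ∈ symbolicPower p 2 →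
        MvPolynomial.eval (fun i => algebraMap A R (v i)) g ∈ p := by
  classical
  by_cases hall : ∀ i, φ (MvPowerSeries.X i) = 0
  · have hM := MvPolynomial.isPrime_map_C (σ := Fin d) (maximalIdeal R)
    refine ⟨1, fun h => hM.ne_top ((Ideal.eq_top_iff_one _).mpr h), ?_⟩
    rintro p hp ⟨i, hi⟩
    exact absurd (by rw [hall i]; exact p.zero_mem) hi
  have hM := MvPolynomial.isPrime_map_C (σ := Fin d) (maximalIdeal R)
  set M : Ideal (MvPolynomial (Fin d) R) := (maximalIdeal R).map MvPolynomial.C with hMdef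
  obtain ⟨m, f, hf⟩ := Submodule.fg_iff_exists_fin_generating_family.mp
    (IsNoetherian.noetherian (RingHom.ker φ))
  change Ideal.span (Set.range f) = RingHom.ker φ at hf
  have hfk : ∀ j, φ (f j) = 0 := fun j => by
    rw [← RingHom.mem_ker, ← hf]
    exact Ideal.subset_span ⟨j, rfl⟩
  set ψ := conormalMap (jacobian φ f) with hψ
  have hJ : (RingHom.ker ψ).IsPrime := RingHom.ker_isPrime ψ
  have hΘ : ∀ p : Ideal R, ∀ _ : p.IsPrime, ∀ v : Fin d → A,
      ∑ i, algebraMap A R (v i) * φ (MvPowerSeries.X i) ∈ symbolicPower p 2 →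
      ∃ Θ : MvPolynomial (Fin m) R →+* p.ResidueField,
        (∀ r, Θ (MvPolynomial.C r) = algebraMap R _ r) ∧
        (∀ g, Θ (ψ g) = algebraMap R _ (MvPolynomial.eval (fun i => algebraMap A R (v i)) g)) ∧
        Θ (ψ (∑ i, MvPolynomial.C (φ (MvPowerSeries.X i)) * MvPolynomial.X i)) = 0 := by
    intro p hp v hv
    obtain ⟨hvp, s, hs, h, hh⟩ := exists_sum_jacobian_of_mem_symbolicPower hφ hC hf p v hv
    obtain ⟨Θ, h1, h2⟩ := exists_ringHom_residueField_conormalMap (jacobian φ f) p _ hs h hh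
    refine ⟨Θ, h1, h2, ?_⟩
    rw [h2, Ideal.algebraMap_residueField_eq_zero]
    convert hvp using 1
    rw [map_sum]
    refine Finset.sum_congr rfl fun i _ => ?_
    rw [map_mul, MvPolynomial.eval_C, MvPolynomial.eval_X, mul_comm]
  by_cases hle : RingHom.ker ψ ≤ M
  swap
  · obtain ⟨g, hg, hgM⟩ := SetLike.not_le_iff_exists.mp hle
    refine ⟨g, hgM, fun p hp _ v hv => ?_⟩
    obtain ⟨Θ, -, h2, -⟩ := hΘ p hp v hv
    have h3 := h2 g
    rw [RingHom.mem_ker.mp hg, map_zero] at h3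
    exact Ideal.algebraMap_residueField_eq_zero.mp h3.symm
  -- by dimension theory there is at most one step between the kernel and `M`
  have hmin : ∀ q : Ideal (MvPolynomial (Fin d) R), q.IsPrime → RingHom.ker ψ < q → q ≤ M →
      q = M := by
    intro q hq hlt hqM
    by_contra hne
    have h1 := Ideal.height_add_one_le_of_lt_of_isPrime hlt
    have h2 := Ideal.height_add_one_le_of_lt_of_isPrime (lt_of_le_of_ne hqM hne)
    have h3 := MvPolynomial.height_map_C_le (σ := Fin d) (maximalIdeal R)
    have h4 := Ideal.height_ker_add_height_le hφ (maximalIdeal R)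
    have h5 := le_height_ker_add_height_ker_conormalMap hφ f hfk
    rw [← hMdef] at h3
    rw [← hψ] at h5
    have h6 : (d : ℕ∞) + 2 ≤ (d + 1 : ℕ) := calc
      (d : ℕ∞) + 2 ≤ (RingHom.ker φ).height + (RingHom.ker ψ).height + 2 := by gcongr
      _ = (RingHom.ker φ).height + ((RingHom.ker ψ).height + 1 + 1) := by ring
      _ ≤ (RingHom.ker φ).height + (q.height + 1) := by gcongr
      _ ≤ (RingHom.ker φ).height + M.height := by gcongr
      _ ≤ (RingHom.ker φ).height + (maximalIdeal R).height := by gcongr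
      _ ≤ _ := h4.trans hht
    norm_cast at h6
    omega
  set y : MvPolynomial (Fin m) R :=
    ψ (∑ i, MvPolynomial.C (φ (MvPowerSeries.X i)) * MvPolynomial.X i) with hy
  have hy0 : y ≠ 0 := by
    intro hy0
    refine hall (eq_zero_of_sum_mul_jacobian_eq_zero hφ hC hf (fun j => ?_) hres hπ0 hπ hle hmin)
    have h1 := congrArg (MvPolynomial.coeff (Finsupp.single j 1)) hy0
    rw [hy, map_sum] at h1
    simp only [map_mul, hψ, conormalMap_C, conormalMap_X, Finset.mul_sum, MvPolynomial.coeff_sum,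
      MvPolynomial.coeff_C_mul, MvPolynomial.coeff_X, MvPolynomial.coeff_zero] at h1
    simpa [Finsupp.single_left_inj] using h1
  -- each component of the locus `y = 0` gives an equation, unless it lies over the closed point
  have hQ : ∀ Q ∈ (Ideal.span {y}).minimalPrimes, ∃ g ∉ M, ψ g ∈ Q ∨
      Q.comap MvPolynomial.C = maximalIdeal R := by
    intro Q hQ
    have hQp := hQ.1.1
    have hyQ : y ∈ Q := hQ.1.2 (Ideal.mem_span_singleton_self y)
    by_cases hQm : Q.comap MvPolynomial.C = maximalIdeal R
    · exact ⟨1, fun h => hM.ne_top ((Ideal.eq_top_iff_one _).mpr h), Or.inr hQm⟩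
    by_contra! hcon
    have hQM : Q.comap ψ ≤ M := fun g hg => by
      by_contra hgM
      exact (hcon g hgM).1 hg
    have hlt : RingHom.ker ψ < Q.comap ψ := by
      refine lt_of_le_of_ne (Ideal.comap_mono bot_le) fun h => hy0 ?_
      have h1 : (∑ i, MvPolynomial.C (φ (MvPowerSeries.X i)) * MvPolynomial.X i) ∈
        RingHom.ker ψ := h ▸ hyQ
      exact h1
    have h1 := hmin _ (hQp.comap _) hlt hQM
    apply hQm
    rw [← MvPolynomial.comap_C_map_C (σ := Fin d) (maximalIdeal R), ← hMdef, ← h1]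
    ext r
    rw [Ideal.mem_comap, Ideal.mem_comap, Ideal.mem_comap, hψ, conormalMap_C]
  choose! g hgM hg using hQ
  have hfin := Ideal.finite_minimalPrimes_of_isNoetherianRing _ (Ideal.span {y})
  refine ⟨∏ Q ∈ hfin.toFinset, g Q, fun h => ?_, fun p hp hxp v hv => ?_⟩
  · obtain ⟨Q, hQ, hgQ⟩ := hM.prod_mem_iff.mp h
    exact hgM Q (hfin.mem_toFinset.mp hQ) hgQ
  obtain ⟨Θ, h1, h2, h3⟩ := hΘ p hp v hv
  have hker : (RingHom.ker Θ).IsPrime := RingHom.ker_isPrime Θ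
  obtain ⟨Q, hQ, hQle⟩ := Ideal.exists_minimalPrimes_le
    (I := Ideal.span {y}) (J := RingHom.ker Θ)
    ((Ideal.span_singleton_le_iff_mem _).mpr h3)
  rw [map_prod]
  refine hp.prod_mem_iff.mpr ⟨Q, hfin.mem_toFinset.mpr hQ, ?_⟩
  rcases hg Q hQ with hgQ | hQm
  · have h4 := RingHom.mem_ker.mp (hQle hgQ)
    rw [h2] at h4
    exact Ideal.algebraMap_residueField_eq_zero.mp h4
  · exfalso
    obtain ⟨i, hi⟩ := hxp
    apply hi
    have h4 : φ (MvPowerSeries.X i) ∈ Q.comap MvPolynomial.C := hQm ▸ hX i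
    have h5 := RingHom.mem_ker.mp (hQle h4)
    rw [h1] at h5
    exact Ideal.algebraMap_residueField_eq_zero.mp h5

/-! ### The Zariski topology on projective space -/

theorem MvPolynomial.IsHomogeneous.eval_smul {k σ : Type*} [CommRing k] {n : ℕ}
    {f : MvPolynomial σ k} (hf : f.IsHomogeneous n) (t : k) (v : σ → k) :
    MvPolynomial.eval (t • v) f = t ^ n * MvPolynomial.eval v f := by
  simp only [MvPolynomial.eval_eq, Finset.mul_sum, Pi.smul_apply, smul_eq_mul, mul_pow,
    Finset.prod_mul_distrib]
  refine Finset.sum_congr rfl fun m hm => ?_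
  have h2 := hf (MvPolynomial.mem_support_iff.mp hm)
  rw [Finsupp.weight_apply, Finsupp.sum] at h2
  simp only [Pi.one_apply, smul_eq_mul, mul_one] at h2
  rw [Finset.prod_pow_eq_pow_sum, h2]
  ring

theorem projBasicOpen_mul {k : Type*} [Field k] {d : ℕ} (f g : MvPolynomial (Fin d) k) :
    projBasicOpen (f * g) = projBasicOpen f ∩ projBasicOpen g := by
  ext P
  simp [projBasicOpen]

theorem isOpen_projBasicOpen {k : Type*} [Field k] {d n : ℕ} {f : MvPolynomial (Fin d) k}
    (hf : f.IsHomogeneous n) : IsOpen (projBasicOpen f) :=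
  TopologicalSpace.isOpen_generateFrom_of_mem ⟨n, f, hf, rfl⟩

theorem exists_projBasicOpen_subset {k : Type*} [Field k] {d : ℕ} {V : Set (ℙ k (Fin d → k))}
    (hV : IsOpen V) {P : ℙ k (Fin d → k)} (hP : P ∈ V) :
    ∃ (n : ℕ) (f : MvPolynomial (Fin d) k), f.IsHomogeneous n ∧ P ∈ projBasicOpen f ∧
      projBasicOpen f ⊆ V := by
  induction hV with
  | basic V hV =>
    obtain ⟨n, f, hf, rfl⟩ := hV
    exact ⟨n, f, hf, hP, subset_rfl⟩
  | univ =>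
    exact ⟨0, 1, MvPolynomial.isHomogeneous_one _ _, by simp [projBasicOpen], Set.subset_univ _⟩
  | inter V W _ _ ihV ihW =>
    obtain ⟨n, f, hf, hPf, hfV⟩ := ihV hP.1
    obtain ⟨n', g, hg, hPg, hgW⟩ := ihW hP.2
    refine ⟨n + n', f * g, hf.mul hg, ?_, ?_⟩
    · rw [projBasicOpen_mul]
      exact ⟨hPf, hPg⟩
    · rw [projBasicOpen_mul]
      exact Set.inter_subset_inter hfV hgW
  | sUnion S _ ih =>
    obtain ⟨V, hVS, hPV⟩ := hP
    obtain ⟨n, f, hf, hPf, hfV⟩ := ih V hVS hPV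
    exact ⟨n, f, hf, hPf, hfV.trans (Set.subset_sUnion_of_mem hVS)⟩

theorem dense_projBasicOpen {k : Type*} [Field k] [Infinite k] {d n : ℕ}
    {f : MvPolynomial (Fin d) k} (hf : f.IsHomogeneous n) (hf0 : f ≠ 0) :
    Dense (projBasicOpen f) := by
  rw [dense_iff_inter_open]
  rintro V hV ⟨P, hP⟩
  obtain ⟨n', g, hg, hPg, hgV⟩ := exists_projBasicOpen_subset hV hP
  have hg0 : g ≠ 0 := by
    rintro rfl
    simp [projBasicOpen] at hPg
  obtain ⟨i, -⟩ := Function.ne_iff.mp P.rep_nonzero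
  -- the factor `X i` ensures that a point of `k ^ d` where the product is nonzero is not the origin
  have h0 : f * g * MvPolynomial.X i ≠ 0 :=
    mul_ne_zero (mul_ne_zero hf0 hg0) (MvPolynomial.X_ne_zero i)
  obtain ⟨v, hv⟩ : ∃ v, MvPolynomial.eval v (f * g * MvPolynomial.X i) ≠ 0 := by
    by_contra! h
    exact h0 (MvPolynomial.funext fun v => by rw [h v, map_zero])
  rw [map_mul, map_mul, MvPolynomial.eval_X] at hv
  have hv0 : v ≠ 0 := fun h => right_ne_zero_of_mul hv (by rw [h, Pi.zero_apply])
  exact ⟨Projectivization.mk k v hv0,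
    hgV ((mk_mem_projBasicOpen hg v hv0).mpr (right_ne_zero_of_mul (left_ne_zero_of_mul hv))),
    (mk_mem_projBasicOpen hf v hv0).mpr (left_ne_zero_of_mul (left_ne_zero_of_mul hv))⟩

/-- Over an infinite field, all homogeneous components of a polynomial vanish at a point if the
polynomial vanishes on the punctured line through it. -/
theorem MvPolynomial.eval_homogeneousComponent_eq_zero {k σ : Type*} [Field k] [Infinite k]
    (F : MvPolynomial σ k) (w : σ → k) (hF : ∀ t : k, t ≠ 0 → MvPolynomial.eval (t • w) F = 0)
    (n : ℕ) : MvPolynomial.eval w (MvPolynomial.homogeneousComponent n F) = 0 := by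
  let q : Polynomial k := ∑ i ∈ Finset.range (F.totalDegree + 1),
    Polynomial.monomial i (MvPolynomial.eval w (MvPolynomial.homogeneousComponent i F))
  have hq : q = 0 := by
    refine Polynomial.eq_zero_of_infinite_isRoot q
      ((Set.finite_singleton (0 : k)).infinite_compl.mono fun t ht => ?_)
    have h1 := hF t ht
    rw [← MvPolynomial.sum_homogeneousComponent F, map_sum] at h1
    simp only [(MvPolynomial.homogeneousComponent_isHomogeneous _ F).eval_smul] at h1
    simp only [q, Set.mem_ofPred_eq, Polynomial.IsRoot, Polynomial.eval_finsetSum,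
      Polynomial.eval_monomial]
    rw [← h1]
    exact Finset.sum_congr rfl fun i _ => mul_comm _ _
  rcases lt_or_ge F.totalDegree n with h | h
  · rw [MvPolynomial.homogeneousComponent_eq_zero n F h, map_zero]
  · have h1 := congrArg (Polynomial.coeff · n) hq
    simpa [q, Polynomial.finsetSum_coeff, Polynomial.coeff_monomial, Nat.lt_succ_of_le h] using h1

/-! ### Minimal generators, coefficient rings and specialization -/

theorem IsMinimalGenerators.span_range_eq {R : Type*} [CommRing R] [IsLocalRing R]
    [IsNoetherianRing R] {n : ℕ} {y : Fin n → R} (hy : IsMinimalGenerators y) :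
    Ideal.span (Set.range y) = maximalIdeal R := by
  obtain ⟨hmem, -, hspan⟩ := hy
  have h1 : Submodule.span R (Set.range fun i => (⟨y i, hmem i⟩ : maximalIdeal R)) = ⊤ := by
    rw [← CotangentSpace.span_image_eq_top_iff, ← Set.range_comp]
    exact hspan
  have h2 := congrArg (Submodule.map (maximalIdeal R).subtype) h1
  rw [Submodule.map_span, ← Set.range_comp, Submodule.map_top, Submodule.range_subtype] at h2
  exact h2

theorem IsCoefficientRingMap.exists_sub_mem {A R : Type*} [CommRing A] [IsLocalRing A]
    [CommRing R] [IsLocalRing R] [Algebra A R] (h : IsCoefficientRingMap A R) (r : R) :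
    ∃ a, r - algebraMap A R a ∈ maximalIdeal R := by
  have := h.isLocalHom
  obtain ⟨b, hb⟩ := h.residue_bijective.2 (residue R r)
  obtain ⟨a, rfl⟩ := residue_surjective b
  refine ⟨a, ?_⟩
  rw [← residue_eq_zero_iff, map_sub, sub_eq_zero, ← hb, ResidueField.map_residue]

theorem IsCoefficientRingMap.injective {A R : Type*} [CommRing A] [IsLocalRing A]
    [CommRing R] [IsLocalRing R] [Algebra A R] (h : IsCoefficientRingMap A R) :
    Function.Injective (algebraMap A R) := by
  have := h.isLocalHom
  have := h.flat
  have := Module.FaithfullyFlat.of_flat_of_isLocalHom (A := A) (B := R)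
  exact FaithfulSMul.algebraMap_injective A R

theorem finite_primeSpectrum_of_isDiscreteValuationRing (A : Type*) [CommRing A] [IsDomain A]
    [IsDiscreteValuationRing A] : Finite (PrimeSpectrum A) := by
  refine Set.finite_univ_iff.mp ((Set.toFinite
    {(⟨⊥, Ideal.isPrime_bot⟩ : PrimeSpectrum A), closedPoint A}).subset fun P _ => ?_)
  by_cases h : P.asIdeal = ⊥
  · exact Or.inl (PrimeSpectrum.ext h)
  · exact Or.inr (PrimeSpectrum.ext (eq_maximalIdeal (P.isPrime.isMaximal h)))

/-- For a nonzero polynomial `F`, not necessarily homogeneous, there is a dense open set of points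
of projective space none of whose lifts has all its unit multiples on the zero locus of `F`. -/
theorem exists_isOpen_dense_specialization_notMem {A : Type*} [CommRing A] [IsLocalRing A]
    [Infinite (ResidueField A)] {d : ℕ} {F : MvPolynomial (Fin d) (ResidueField A)} (hF : F ≠ 0) :
    ∃ U : Set (ℙ (ResidueField A) (Fin d → ResidueField A)), IsOpen U ∧ Dense U ∧
      ∀ v : NormalizedTuple A d, specialization A d v.toProj ∈ U →
        ∃ u : Aˣ, MvPolynomial.eval (fun i => residue A (u * v.1 i)) F ≠ 0 := by
  obtain ⟨n, hn⟩ : ∃ n, MvPolynomial.homogeneousComponent n F ≠ 0 := by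
    by_contra! h
    exact hF (by rw [← MvPolynomial.sum_homogeneousComponent F,
      Finset.sum_congr rfl fun i _ => h i, Finset.sum_const_zero])
  have hhom := MvPolynomial.homogeneousComponent_isHomogeneous n F
  refine ⟨_, isOpen_projBasicOpen hhom, dense_projBasicOpen hhom hn, fun v hv => ?_⟩
  by_contra! h
  refine (mk_mem_projBasicOpen hhom _ v.residue_ne_zero).mp hv
    (MvPolynomial.eval_homogeneousComponent_eq_zero F _ (fun t ht => ?_) n)
  obtain ⟨u, rfl⟩ := residue_surjective t
  have hu : IsUnit u := (residue_ne_zero_iff_isUnit u).mp ht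
  have h1 := h hu.unit
  simp only [map_mul, IsUnit.unit_spec] at h1
  exact h1

theorem proposition4p5 {A R : Type*} [CommRing A] [IsDomain A] [IsDiscreteValuationRing A]
    [IsAdicComplete (maximalIdeal A) A] (p : ℕ) (hA : IsUnramifiedMixedChar A p)
    [CommRing R] [IsDomain R] [IsLocalRing R] [IsNoetherianRing R]
    [IsAdicComplete (maximalIdeal R) R]
    [Algebra A R] (hAR : IsCoefficientRingMap A R)
    (π : A) (hπ : Irreducible π) (d : ℕ) (x : Fin d → R)
    (hx : IsMinimalGenerators (Fin.cons (algebraMap A R π) x : Fin (d + 1) → R))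
    [Infinite (ResidueField A)] :
    {q : PrimeSpectrum R | Ideal.span (Set.range x) ≤ q.asIdeal}.Finite ∧
    ∃ U : Set (ℙ (ResidueField A) (Fin d → ResidueField A)), IsOpen U ∧ Dense U ∧
      ∀ P : PrimeSpectrum R, ¬ Ideal.span (Set.range x) ≤ P.asIdeal →
        ∀ α : ProjPoints A d, specialization A d α ∈ U →
          ∀ v : NormalizedTuple A d, v.toProj = α →
            ∑ i, algebraMap A R (v.1 i) * x i ∉ symbolicPower P.asIdeal 2 := by
  have hloc := hAR.isLocalHom
  have hcharA := hA.charZero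
  have hcharR : CharZero R := charZero_of_injective_algebraMap hAR.injective
  have hmA : maximalIdeal A = Ideal.span {π} := hπ.maximalIdeal_eq
  have hπA : π ∈ maximalIdeal A := hmA ▸ Ideal.mem_span_singleton_self π
  have hxm : ∀ i, x i ∈ maximalIdeal R := fun i => by
    simpa using hx.choose i.succ
  have hm : maximalIdeal R = Ideal.span {algebraMap A R π} ⊔ Ideal.span (Set.range x) := by
    rw [← hx.span_range_eq, Fin.range_cons, Ideal.span_insert]
  have hπR : algebraMap A R π ∈ maximalIdeal R := by
    simpa using hx.choose 0
  constructor
  · have hsurj := algebraMap_quotient_span_surjective hπA hAR.exists_sub_mem hm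
    have := finite_primeSpectrum_of_isDiscreteValuationRing A
    refine Set.Finite.of_finite_image (f := PrimeSpectrum.comap (algebraMap A R))
      (Set.toFinite _) fun q hq q' hq' hqq => ?_
    have key : ∀ q q' : PrimeSpectrum R, Ideal.span (Set.range x) ≤ q.asIdeal →
        Ideal.span (Set.range x) ≤ q'.asIdeal →
        PrimeSpectrum.comap (algebraMap A R) q = PrimeSpectrum.comap (algebraMap A R) q' →
        q.asIdeal ≤ q'.asIdeal := by
      intro q q' hq hq' hqq r hr
      obtain ⟨a, ha⟩ := hsurj (Ideal.Quotient.mk _ r)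
      have h1 : algebraMap A R a - r ∈ Ideal.span (Set.range x) := Ideal.Quotient.eq.mp ha
      have h2 : algebraMap A R a ∈ q.asIdeal := by
        simpa using q.asIdeal.add_mem (hq h1) hr
      have h3 : a ∈ (PrimeSpectrum.comap (algebraMap A R) q').asIdeal := hqq ▸ h2
      simpa using q'.asIdeal.sub_mem (show algebraMap A R a ∈ q'.asIdeal from h3) (hq' h1)
    exact PrimeSpectrum.ext (le_antisymm (key q q' hq hq' hqq) (key q' q hq' hq hqq.symm))
  obtain ⟨φ, hC, hX⟩ := MvPowerSeries.exists_ringHom_X_eq (A := A) (maximalIdeal R) x hxm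
  have hφ := surjective_of_map_X_eq hπA hAR.exists_sub_mem hm hC hX
  obtain ⟨g, hgm, hg⟩ := exists_polynomial_eval_mem hφ hC (fun i => (hX i).symm ▸ hxm i)
    hAR.exists_sub_mem
    (height_comap_maximalIdeal_le hmA hC fun i => (hX i).symm ▸ hxm i)
    (fun h => hπ.ne_zero (hAR.injective (h.trans (map_zero _).symm))) hπR
  let e := RingEquiv.ofBijective _ hAR.residue_bijective
  have he : ∀ a, e (residue A a) = residue R (algebraMap A R a) := fun a => rfl
  let F : MvPolynomial (Fin d) (ResidueField A) :=
    MvPolynomial.map (e.symm : ResidueField R →+* ResidueField A) (MvPolynomial.map (residue R) g)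
  have hF : F ≠ 0 := by
    intro h0
    apply hgm
    rw [MvPolynomial.map_C_eq_ker_map, RingHom.mem_ker]
    exact (MvPolynomial.map_injective _ e.symm.injective) (h0.trans (map_zero _).symm)
  obtain ⟨U, hUo, hUd, hU⟩ := exists_isOpen_dense_specialization_notMem hF
  refine ⟨U, hUo, hUd, ?_⟩
  rintro P hP _ hv v rfl hmem
  obtain ⟨u, hu⟩ := hU v hv
  have hxP : ∃ i, φ (MvPowerSeries.X i) ∉ P.asIdeal := by
    by_contra! h
    refine hP (Ideal.span_le.mpr ?_)
    rintro _ ⟨i, rfl⟩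
    exact hX i ▸ h i
  have h1 := hg P.asIdeal P.isPrime hxP (fun i => u * v.1 i) (by
    have h2 := Ideal.mul_mem_left _ (algebraMap A R u) hmem
    rw [Finset.mul_sum] at h2
    simp only [map_mul, hX]
    simpa only [mul_assoc] using h2)
  apply hu
  apply e.injective
  have h3 : ((e : ResidueField A →+* ResidueField R).comp
      (MvPolynomial.eval fun i => residue A (u * v.1 i))).comp
        ((MvPolynomial.map (e.symm : ResidueField R →+* ResidueField A)).comp
          (MvPolynomial.map (residue R))) =
      (residue R).comp (MvPolynomial.eval fun i => algebraMap A R (u * v.1 i)) :=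
    MvPolynomial.ringHom_ext (fun r => by simp) (fun i => by simp [he])
  rw [map_zero]
  refine (RingHom.congr_fun h3 g).trans ((residue_eq_zero_iff _).mpr ?_)
  exact le_maximalIdeal P.isPrime.ne_top h1
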